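/- **Setting.** Let $U$ be a compact metric space, $Y\subset\mathbb R^m$ and $Z\subset\mathbb R^n$ compact, $z_0\in Z$, $C>0$. Let $f:U\times\mathbb R^m\times\mathbb R^n\to\mathbb R^m$, $g:U\times\mathbb R^m\times\mathbb R^n\to\mathbb R^n$, $G:U\times\mathbb R^m\times\mathbb R^n\to\mathbb R$ be continuous, with $f$ Lipschitz in $(u,y,z)$ on $U\times Y\times Z$ and $g$ Lipschitz in $(y,z)$ on $Y\times Z$ uniformly in $u$. For a compact metric space $K$, $\mathcal P(K)$ is the space of Borel probability measures with the weak$^*$ topology. On $\mathcal P(U\times Y)$ use the metric $\rho(\gamma',\gamma'')=\sum_{l\ge1}2^{-l}|\int q_l\,d\gamma'-\int q_l\,d\gamma''|$, where $(q_l)$ is a sequence of Lipschitz functions dense in the unit ball of $C(U\times Y)$. For $\mu\in\mathcal P(U\times Y)$ put $\tilde g(\mu,z)=\int g(u,y,z)\,\mu(du,dy)$, $\tilde G(\mu,z)=\int G(u,y,z)\,\mu(du,dy)$. A measurable $w:[0,\infty)\to K$ *generates the occupational measure* $\gamma\in\mathcal P(K)$ if $\frac1S\int_0^S q(w(\tau))\,d\tau\to\int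 q\,d\gamma$ as $S\to\infty$ for all $q\in C(K)$. A pair $(u,y):[0,\infty)\to U\times Y$ is *admissible for the associated system* with parameter $z\in Z$ if $u$ is measurable, $y$ is locally absolutely continuous and $y'(\tau)=f(u(\tau),y(\tau),z)$ a.e. Let $$W(z)=\Big\{\mu\in\mathcal P(U\times Y):\int\nabla\phi(y)^Tf(u,y,z)\,\mu(du,dy)=0\ \ \forall\phi\in C^1(\mathbb R^m)\Big\},$$ and let $F=\{(\mu,z):z\in Z,\ \mu\in W(z)\}$ be its graph. A pair $(\mu(\cdot),z(\cdot))$, $\mu(t)\in\mathcal P(U\times Y)$, $z(t)\in Z$, $t\ge0$, is *admissible for the averaged system* if $\mu$ is measurable, $z$ is locally absolutely continuous and, for a.e. $t$, $z'(t)=\tilde g(\mu(t),z(t))$ and $\mu(t)\in W(z(t))$. The averaged problem is $$\tilde V^*=\inf\int_0^\infty e^{-Ct}\tilde G(\mu(t),z(t))\,dt$$ over admissible pairs with $z(0)=z_0$. The averaged IDLP problem is to minimize $\int\tilde G\,dp$ over the set $\tilde{\mathcal D}$ of $p\in\mathcal P(F)$ with $\int[\nabla\psi(z)^T\tilde g(\mu,z)+C(\psi(z_0)-\psi(z))]\,p(d\mu,dz)=0$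 for all $\psi\in C^1(\mathbb R^n)$; its value is $\tilde G^*$. A family $(u_z(\cdot),y_z(\cdot))_{z\in Z}$ of admissible pairs of the associated systems, where $(u_z,y_z)$ generates the occupational measure $\mu(z)$, is an *ACG (average control generating) family* if, for every $q\in C(U\times Y\times Z)$, $z\mapsto\int q(u,y,z)\,\mu(z)(du,dy)$ is measurable and $\frac1S\int_0^Sq(u_z(\tau),y_z(\tau),z)\,d\tau\to\int q(u,y,z)\,\mu(z)(du,dy)$ as $S\to\infty$ uniformly in $z\in Z$, and if $z'(t)=\tilde g(\mu(z(t)),z(t))$, $z(0)=z_0$, has a unique $Z$-valued solution $z(t)$ on $[0,\infty)$. It is *$\alpha$-near optimal* ($\alpha>0$) if $\int_0^\infty e^{-Ct}\tilde G(\mu(z(t)),z(t))\,dt\le\tilde V^*+\alpha$. **Approximation** ($N,M\ge1$). Let $\psi_i\in C^1(\mathbb R^n)$ and $\phi_i\in C^1(\mathbb R^m)$, $i\ge1$, be such that every $C^1$ function is approximated, together with its gradient and uniformly on compact sets, by linear combinations of the $\psi_i$ (resp. $\phi_i$). Let $W_M(z)$ be defined as $W(z)$ but with $\phi=\phi_1,\dots,\phi_M$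 only, $F_M$ its graph, and $\tilde G^{N,M}$ the minimum of $\int\tilde G\,dp$ over $p\in\mathcal P(F_M)$ satisfying the constraints of $\tilde{\mathcal D}$ for $\psi=\psi_1,\dots,\psi_N$ only. Assume that there are, and fix: * for all $N,M$, a solution $\zeta^{N,M}\in\mathrm{span}(\psi_1,\dots,\psi_N)$ of the approximating averaged dual problem: $\tilde G^{N,M}\le\tilde G(\mu,z)+\nabla\zeta^{N,M}(z)^T\tilde g(\mu,z)+C(\zeta^{N,M}(z_0)-\zeta^{N,M}(z))$ on $F_M$; * for all $N,M$ and $z\in Z$, a solution $\eta_z^{N,M}\in\mathrm{span}(\phi_1,\dots,\phi_M)$ of the approximating associated dual problem. With $H_\eta(u,y,z)=G(u,y,z)+\nabla\zeta^{N,M}(z)^Tg(u,y,z)+\nabla\eta(y)^Tf(u,y,z)$, this means $\sup\{\theta:\exists\eta\in\mathrm{span}(\phi_1,\dots,\phi_M),\ \theta\le H_\eta(u,y,z)\ \forall (u,y)\in U\times Y\}\le H_{\eta_z^{N,M}}(u,y,z)$ for all $(u,y)\in U\times Y$; * a minimizer $u^{N,M}(y,z)$ of $u\mapsto H_{\eta^{N,M}_z}(u,y,z)$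 over $U$, for all $(y,z)\in Y\times Z$. Assume that for all $y_0\in Y$, $z\in Z$ the system $y'(\tau)=f(u^{N,M}(y(\tau),z),y(\tau),z)$, $y(0)=y_0$, has a unique $Y$-valued solution on $[0,\infty)$ (a solution $y$ being such that $(u^{N,M}(y(\cdot),z),y(\cdot))$ is admissible). Choose initial values $y_0^{N,M}(z)\in Y$, let $y_z^{N,M}$ be the solution with $y_z^{N,M}(0)=y_0^{N,M}(z)$, and $u_z^{N,M}(\tau)=u^{N,M}(y_z^{N,M}(\tau),z)$. For real $a(N,M)$, "$a(N,M)\to0$" means $\lim_{N\to\infty}\limsup_{M\to\infty}a(N,M)=0$. **Assumption 1.** (i) The averaged IDLP problem has a unique optimal solution, and $C\tilde V^*=\tilde G^*$. (ii) The averaged problem has an optimal solution $(\mu^*(\cdot),z^*(\cdot))$; $\mu^*$ has finitely many discontinuities on each bounded interval and is left- or right-continuous at each of them. (iii) For a.e. $t\ge0$ there is an admissible pair $(u_t^*,y_t^*)$ of the associated system with parameter $z^*(t)$ that generates the occupational measure $\mu^*(t)$, and for a.e. $\tau\ge 0$ every ball around $(u^*_t(\tau),y_t^*(\tau))$ has positive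 $\mu^*(t)$-measure. (iv) For each $z\in Z$, $(u_z^{N,M},y_z^{N,M})$ generates an occupational measure $\mu^{N,M}(z)$; $z\mapsto\int q\,d\mu^{N,M}(z)$ is measurable for all $q\in C(U\times Y)$; and there are functions $b_q(S)\to0$ ($S\to\infty$), independent of $z,N,M$, with $$\Big|\frac1S\int_0^Sq(u_z^{N,M}(\tau),y_z^{N,M}(\tau))\,d\tau-\int q\,d\mu^{N,M}(z)\Big|\le b_q(S)\qquad\forall S>0.$$ Moreover, for a.e. $t$ and all $N,M$, for $z=z^*(t)$ the solutions starting at any point of $Y$ in some neighbourhood of the curve $y_t^*(\cdot)$ also generate $\mu^{N,M}(z)$, with the same estimate. **Assumption 2.** For a.e. $t\ge0$ there is an open ball $Q_t\subset\mathbb R^n$ centered at $z^*(t)$ such that: (i) $\rho(\mu^{N,M}(z'),\mu^{N,M}(z''))\le\kappa_t(\|z'-z''\|)$ for all $N,M$ and distinct $z',z''\in Q_t\cap Z$, where $\kappa_t(\theta)\to0$ as $\theta\to0$ and $\kappa_t$ does not depend on $N,M$; and $\|\tilde g(\mu^{N,M}(z'),z')-\tilde g(\mu^{N,M}(z''),z'')\|\le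 L\|z'-z''\|$ for $z',z''\in Q_t\cap Z$, with $L$ independent of $t,N,M$; (ii) the system $z'(t)=\tilde g(\mu^{N,M}(z(t)),z(t))$, $z(0)=z_0$, has a unique $Z$-valued solution $z^{N,M}(t)$ on $[0,\infty)$, and $\mathrm{meas}\{t'\in[0,t]:z^{N,M}(t')\notin Q_{t'}\}\to0$ for each $t>0$ (with $Q_{t'}=\emptyset$ for exceptional $t'$). **Assumption 3.** For a.e. $t\ge0$ (with $Q_t\neq\emptyset$): (i) for a.e. $\tau\ge0$ there is an open ball $B_{t,\tau}\subset\mathbb R^m$ centered at $y_t^*(\tau)$ such that, for all $N,M$, the minimizer $u^{N,M}(y,z)$ is unique for $(y,z)\in(B_{t,\tau}\cap Y)\times(Q_t\cap Z)$; (ii) $u^{N,M}$ is Lipschitz in $(y,z)$ on this set with a constant independent of $\tau,N,M$; (iii) if $y_t^{N,M}$ is the solution of the closed-loop system with $z=z^*(t)$ and $y(0)=y_t^*(0)$, then $\mathrm{meas}\{\tau'\in[0,\tau]:y_t^{N,M}(\tau')\notin B_{t,\tau'}\}\to0$ for each $\tau>0$ (with $B_{t,\tau'}=\emptyset$ for exceptional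 $\tau'$). **Theorem.** Under Assumptions 1, 2 and 3 there are $\beta(N,M)>0$ with $\lim_{N\to\infty}\limsup_{M\to\infty}\beta(N,M)=0$ such that, for all $N,M\ge1$, $(u_z^{N,M}(\cdot),y_z^{N,M}(\cdot))_{z\in Z}$ is a $\beta(N,M)$-near optimal ACG family. Moreover, $$\lim_{N\to\infty}\limsup_{M\to\infty}\max_{t'\in[0,t]}\|z^{N,M}(t')-z^*(t')\|=0\quad\forall t\ge0,$$ $$\lim_{N\to\infty}\limsup_{M\to\infty}\rho(\mu^{N,M}(z^{N,M}(t)),\mu^*(t))=0\quad\text{for a.e. }t\ge0,$$ $$\lim_{N\to\infty}\limsup_{M\to\infty}\Big|\int_0^\infty e^{-Ct}\tilde G(\mu^{N,M}(z^{N,M}(t)),z^{N,M}(t))\,dt-\tilde V^*\Big|=0.$$ -/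

import Mathlib

open MeasureTheory Filter Topology Set

noncomputable section

namespace SPControl

/-- Euclidean space of dimension `k`. -/
abbrev E (k : ℕ) := EuclideanSpace ℝ (Fin k)

/-- `lim_{N → ∞} limsup_{M → ∞} a N M = 0`, with the upper limits taken in `[-∞, ∞]`. -/
def DoubleLimZero (a : ℕ → ℕ → ℝ) : Prop :=
  Tendsto (fun N => limsup (fun M => ((a N M : ℝ) : EReal)) atTop) atTop (𝓝 0)

/-- "For almost all `t ∈ [0, ∞)`" refers to Lebesgue measure on the half line. -/
abbrev halfLine : Measure ℝ := volume.restrict (Ici 0)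

/-- The occupational measure generated on `[0, ∞)` by a measurable function `w` (of which only the
values on `[0, ∞)` matter) exists and equals `γ`. -/
def GeneratesOccupation {W : Type*} [TopologicalSpace W] [MeasurableSpace W]
    (w : ℝ → W) (γ : ProbabilityMeasure W) : Prop :=
  AEMeasurable w halfLine ∧
  ∀ q : C(W, ℝ), Tendsto (fun S : ℝ => S⁻¹ * ∫ τ in (0 : ℝ)..S, q (w τ)) atTop
    (𝓝 (∫ x, q x ∂(γ : Measure W)))

/-- A sequence of Lipschitz functions which is a dense subset of the unit ball of `C(W)`. -/
def IsDenseLipschitzSeq {W : Type*} [PseudoMetricSpace W] (q : ℕ → C(W, ℝ)) : Prop :=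
  (∀ l, ∃ K, LipschitzWith K (q l)) ∧ (∀ l w, |q l w| ≤ 1) ∧
  ∀ h : C(W, ℝ), (∀ w, |h w| ≤ 1) → ∀ ε > 0, ∃ l, ∀ w, |h w - q l w| < ε

/-- The metric `ρ` on probability measures attached to the sequence `q`. -/
def rho {W : Type*} [TopologicalSpace W] [MeasurableSpace W] (q : ℕ → C(W, ℝ))
    (γ γ' : ProbabilityMeasure W) : ℝ :=
  ∑' l : ℕ, (1 / 2 : ℝ) ^ (l + 1) *
    |(∫ w, q l w ∂(γ : Measure W)) - ∫ w, q l w ∂(γ' : Measure W)|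

/-- A sequence of `C¹` functions such that every `C¹` function is approximated, together with its
gradient and uniformly on compact sets, by linear combinations of the sequence. -/
def IsC1Total {k : ℕ} (ψ : ℕ → E k → ℝ) : Prop :=
  (∀ i, ContDiff ℝ 1 (ψ i)) ∧
  ∀ ζ : E k → ℝ, ContDiff ℝ 1 ζ → ∀ K : Set (E k), IsCompact K → ∀ ε > 0,
    ∃ (N : ℕ) (c : ℕ → ℝ), ∀ x ∈ K,
      |ζ x - ∑ i ∈ Finset.range N, c i * ψ i x| < ε ∧
      ‖fderiv ℝ ζ x - ∑ i ∈ Finset.range N, c i • fderiv ℝ (ψ i) x‖ < ε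

/-- The span of the first `N` functions of a sequence. -/
def firstSpan {k : ℕ} (ψ : ℕ → E k → ℝ) (N : ℕ) : Set (E k → ℝ) :=
  {ζ | ∃ c : ℕ → ℝ, ζ = fun x => ∑ i ∈ Finset.range N, c i * ψ i x}

/-- A function on `[0, ∞)` has finitely many discontinuities on every bounded interval and, at each
of them, is continuous from the left or from the right. -/
def PiecewiseOneSidedContinuous {X : Type*} [TopologicalSpace X] (w : ℝ → X) : Prop :=
  (∀ T : ℝ, {t ∈ Icc 0 T | ¬ ContinuousWithinAt w (Ici 0) t}.Finite) ∧
  ∀ t ∈ Ici (0 : ℝ), ContinuousWithinAt w (Icc 0 t) t ∨ ContinuousWithinAt w (Ici t) t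

/-- The data of the singularly perturbed problem
`ε y' = f(u, y, z)`, `z' = g(u, y, z)`, `u ∈ U`, `(y, z) ∈ Y × Z`, `z(0) = z₀`,
with running cost `G` and discount rate `C`. -/
structure SPData (U : Type*) [MetricSpace U] (m n : ℕ) where
  f : U → E m → E n → E m
  g : U → E m → E n → E n
  G : U → E m → E n → ℝ
  C : ℝ
  Y : Set (E m)
  Z : Set (E n)
  z₀ : Z
  f_cont : Continuous fun x : U × E m × E n => f x.1 x.2.1 x.2.2
  g_cont : Continuous fun x : U × E m × E n => g x.1 x.2.1 x.2.2
  G_cont : Continuous fun x : U × E m × E n => G x.1 x.2.1 x.2.2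
  f_lip : ∃ L : ℝ, ∀ u u' : U, ∀ y ∈ Y, ∀ y' ∈ Y, ∀ z ∈ Z, ∀ z' ∈ Z,
    ‖f u y z - f u' y' z'‖ ≤ L * (dist u u' + ‖y - y'‖ + ‖z - z'‖)
  g_lip : ∃ L : ℝ, ∀ u : U, ∀ y ∈ Y, ∀ y' ∈ Y, ∀ z ∈ Z, ∀ z' ∈ Z,
    ‖g u y z - g u y' z'‖ ≤ L * (‖y - y'‖ + ‖z - z'‖)
  C_pos : 0 < C
  Y_compact : IsCompact Y
  Z_compact : IsCompact Z

variable {U : Type*} [MetricSpace U] [CompactSpace U] [MeasurableSpace U] [BorelSpace U]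
  {m n : ℕ}

namespace SPData

variable (D : SPData U m n)

/-- The space `𝒫(U × Y)`, with its weak topology and Borel sigma-algebra. -/
abbrev PUY := ProbabilityMeasure (U × D.Y)

/-- The averaged right-hand side `g̃(μ, z)`. -/
def gTilde (μ : D.PUY) (z : D.Z) : E n :=
  ∫ w, D.g w.1 w.2 z ∂(μ : Measure (U × D.Y))

/-- The averaged cost `G̃(μ, z)`. -/
def GTilde (μ : D.PUY) (z : D.Z) : ℝ :=
  ∫ w, D.G w.1 w.2 z ∂(μ : Measure (U × D.Y))

/-- The set `W(z)`. -/
def W (z : D.Z) : Set D.PUY :=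
  {μ | ∀ φ : E m → ℝ, ContDiff ℝ 1 φ →
    ∫ w, fderiv ℝ φ w.2 (D.f w.1 w.2 z) ∂(μ : Measure (U × D.Y)) = 0}

/-- The set `W_M(z)`, in which only the first `M` functions `φ i` are used. -/
def WM (φ : ℕ → E m → ℝ) (M : ℕ) (z : D.Z) : Set D.PUY :=
  {μ | ∀ i < M, ∫ w, fderiv ℝ (φ i) w.2 (D.f w.1 w.2 z) ∂(μ : Measure (U × D.Y)) = 0}

/-! ### The associated and the averaged systems -/

/-- `(u, y)` is admissible for the associated system with frozen `z` (on `[0, ∞)`). -/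
def AssocAdmissible (z : D.Z) (u : ℝ → U) (y : ℝ → D.Y) : Prop :=
  AEMeasurable u halfLine ∧
  (∀ S > 0, AbsolutelyContinuousOnInterval (fun τ => (y τ : E m)) 0 S) ∧
  ∀ᵐ τ ∂halfLine, HasDerivAt (fun s => (y s : E m)) (D.f (u τ) (y τ) z) τ

/-- `(μ, z)` is admissible for the averaged system (on `[0, ∞)`). -/
def AvgAdmissible (μ : ℝ → D.PUY) (z : ℝ → D.Z) : Prop :=
  AEMeasurable μ halfLine ∧
  (∀ T > 0, AbsolutelyContinuousOnInterval (fun t => (z t : E n)) 0 T) ∧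
  ∀ᵐ t ∂halfLine, μ t ∈ D.W (z t) ∧
    HasDerivAt (fun s => (z s : E n)) (D.gTilde (μ t) (z t)) t

/-- The discounted cost of the averaged problem. -/
def avgCost (μ : ℝ → D.PUY) (z : ℝ → D.Z) : ℝ :=
  ∫ t in Ioi (0 : ℝ), Real.exp (-D.C * t) * D.GTilde (μ t) (z t)

/-- The optimal value `Ṽ*` of the averaged problem. -/
def avgValue : ℝ :=
  sInf {v | ∃ (μ : ℝ → D.PUY) (z : ℝ → D.Z),
    D.AvgAdmissible μ z ∧ z 0 = D.z₀ ∧ v = D.avgCost μ z}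

/-- `(μ, z)` is an optimal solution of the averaged problem. -/
def IsOptimalPair (μ : ℝ → D.PUY) (z : ℝ → D.Z) : Prop :=
  D.AvgAdmissible μ z ∧ z 0 = D.z₀ ∧
  ∀ (μ' : ℝ → D.PUY) (z' : ℝ → D.Z), D.AvgAdmissible μ' z' → z' 0 = D.z₀ →
    D.avgCost μ z ≤ D.avgCost μ' z'

/-! ### The averaged IDLP problem and its approximations -/

/-- The integrand `∇ψ(z)ᵀ g̃(μ, z) + C (ψ(z₀) - ψ(z))` of the constraints. -/
def constraintFun (ψ : E n → ℝ) (μ : D.PUY) (z : D.Z) : ℝ :=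
  fderiv ℝ ψ z (D.gTilde μ z) + D.C * (ψ D.z₀ - ψ z)

/-- The feasible set of the averaged IDLP problem: probability measures on the graph of `W`. -/
def idlpFeasible : Set (ProbabilityMeasure (D.PUY × D.Z)) :=
  {p | (∀ᵐ x ∂(p : Measure (D.PUY × D.Z)), x.1 ∈ D.W x.2) ∧
    ∀ ψ : E n → ℝ, ContDiff ℝ 1 ψ →
      ∫ x, D.constraintFun ψ x.1 x.2 ∂(p : Measure (D.PUY × D.Z)) = 0}

/-- The feasible set of the `(N, M)`-approximating averaged problem. -/
def idlpFeasibleNM (ψ : ℕ → E n → ℝ) (φ : ℕ → E m → ℝ) (N M : ℕ) :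
    Set (ProbabilityMeasure (D.PUY × D.Z)) :=
  {p | (∀ᵐ x ∂(p : Measure (D.PUY × D.Z)), x.1 ∈ D.WM φ M x.2) ∧
    ∀ i < N, ∫ x, D.constraintFun (ψ i) x.1 x.2 ∂(p : Measure (D.PUY × D.Z)) = 0}

/-- The objective of the IDLP problems. -/
def idlpCost (p : ProbabilityMeasure (D.PUY × D.Z)) : ℝ :=
  ∫ x, D.GTilde x.1 x.2 ∂(p : Measure (D.PUY × D.Z))

/-- The optimal value `G̃*` of the averaged IDLP problem. -/
def idlpValue : ℝ := sInf (D.idlpCost '' D.idlpFeasible)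

/-- The optimal value of the `(N, M)`-approximating averaged problem. -/
def idlpValueNM (ψ : ℕ → E n → ℝ) (φ : ℕ → E m → ℝ) (N M : ℕ) : ℝ :=
  sInf (D.idlpCost '' D.idlpFeasibleNM ψ φ N M)

/-- `p` is an optimal solution of the averaged IDLP problem. -/
def IsOptimalIDLP (p : ProbabilityMeasure (D.PUY × D.Z)) : Prop :=
  p ∈ D.idlpFeasible ∧ ∀ p' ∈ D.idlpFeasible, D.idlpCost p ≤ D.idlpCost p'

/-- `ζ` is a solution of the `(N, M)`-approximating averaged dual problem. -/
def IsAvgDualSolution (ψ : ℕ → E n → ℝ) (φ : ℕ → E m → ℝ) (N M : ℕ) (ζ : E n → ℝ) : Prop :=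
  ζ ∈ firstSpan ψ N ∧
  ∀ z : D.Z, ∀ μ ∈ D.WM φ M z,
    D.idlpValueNM ψ φ N M ≤
      D.GTilde μ z + fderiv ℝ ζ z (D.gTilde μ z) + D.C * (ζ D.z₀ - ζ z)

/-- The function `G(u,y,z) + ∇ζ(z)ᵀ g(u,y,z) + ∇η(y)ᵀ f(u,y,z)`. -/
def ham (ζ : E n → ℝ) (η : E m → ℝ) (u : U) (y : D.Y) (z : D.Z) : ℝ :=
  D.G u y z + fderiv ℝ ζ z (D.g u y z) + fderiv ℝ η y (D.f u y z)

/-- The optimal value of the approximating associated dual problem (a supremum in `[-∞, ∞]`). -/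
def assocDualValue (φ : ℕ → E m → ℝ) (M : ℕ) (ζ : E n → ℝ) (z : D.Z) : EReal :=
  sSup {e : EReal | ∃ θ : ℝ, e = θ ∧ ∃ η ∈ firstSpan φ M,
    ∀ (u : U) (y : D.Y), θ ≤ D.ham ζ η u y z}

/-- `η` is a solution of the approximating associated dual problem at `z`. -/
def IsAssocDualSolution (φ : ℕ → E m → ℝ) (M : ℕ) (ζ : E n → ℝ) (z : D.Z) (η : E m → ℝ) : Prop :=
  η ∈ firstSpan φ M ∧
  ∀ (u : U) (y : D.Y), D.assocDualValue φ M ζ z ≤ ((D.ham ζ η u y z : ℝ) : EReal)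

/-! ### Feedback solutions and ACG families -/

/-- `y` solves `y' = f(v(y), y, z)`, `y(0) = y₀` in `Y`, where `v` is a feedback control. -/
def IsClosedLoopSolution (v : D.Y → U) (z : D.Z) (y₀ : D.Y) (y : ℝ → D.Y) : Prop :=
  y 0 = y₀ ∧ D.AssocAdmissible z (fun τ => v (y τ)) y

/-- `y` is the unique such solution on `[0, ∞)`. -/
def IsUniqueClosedLoopSolution (v : D.Y → U) (z : D.Z) (y₀ : D.Y) (y : ℝ → D.Y) : Prop :=
  D.IsClosedLoopSolution v z y₀ y ∧
  ∀ y' : ℝ → D.Y, D.IsClosedLoopSolution v z y₀ y' → EqOn y' y (Ici 0)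

/-- `z` solves `z' = g̃(μ(z), z)`, `z(0) = z₀` in `Z`. -/
def IsAvgFeedbackSolution (μ : D.Z → D.PUY) (z : ℝ → D.Z) : Prop :=
  z 0 = D.z₀ ∧
  (∀ T > 0, AbsolutelyContinuousOnInterval (fun t => (z t : E n)) 0 T) ∧
  ∀ᵐ t ∂halfLine, HasDerivAt (fun s => (z s : E n)) (D.gTilde (μ (z t)) (z t)) t

/-- `z` is the unique such solution on `[0, ∞)`. -/
def IsUniqueAvgFeedbackSolution (μ : D.Z → D.PUY) (z : ℝ → D.Z) : Prop :=
  D.IsAvgFeedbackSolution μ z ∧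
  ∀ z' : ℝ → D.Z, D.IsAvgFeedbackSolution μ z' → EqOn z' z (Ici 0)

/-- `(u_z, y_z)` is an average control generating family, with `μ(du, dy | z)` the family of
occupational measures and `zsol` the trajectory generated by it. -/
structure IsACGFamily (u : D.Z → ℝ → U) (y : D.Z → ℝ → D.Y) (μ : D.Z → D.PUY)
    (zsol : ℝ → D.Z) : Prop where
  admissible : ∀ z, D.AssocAdmissible z (u z) (y z)
  generates : ∀ z, GeneratesOccupation (fun τ => (u z τ, y z τ)) (μ z)
  measurable : ∀ q : C(U × D.Y × D.Z, ℝ),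
    Measurable fun z : D.Z => ∫ w, q (w.1, w.2, z) ∂(μ z : Measure (U × D.Y))
  estimate : ∀ q : C(U × D.Y × D.Z, ℝ), ∃ b : ℝ → ℝ, Tendsto b atTop (𝓝 0) ∧
    ∀ S > 0, ∀ z : D.Z,
      |S⁻¹ * (∫ τ in (0 : ℝ)..S, q (u z τ, y z τ, z)) -
        ∫ w, q (w.1, w.2, z) ∂(μ z : Measure (U × D.Y))| ≤ b S
  unique_solution : D.IsUniqueAvgFeedbackSolution μ zsol

/-- `(u_z, y_z)` is an `α`-near optimal ACG family. -/
def IsNearOptimalACGFamily (α : ℝ) (u : D.Z → ℝ → U) (y : D.Z → ℝ → D.Y) : Prop :=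
  0 < α ∧ ∃ (μ : D.Z → D.PUY) (zsol : ℝ → D.Z), D.IsACGFamily u y μ zsol ∧
    D.avgCost (fun t => μ (zsol t)) zsol ≤ D.avgValue + α

end SPData

/-- The objects of the `(N, M)`-approximation, `N, M ≥ 1`: basis functions, solutions `ζ`, `η` of
the approximating averaged and associated dual problems, a minimizing feedback `u`, and the
solutions `y` of the closed-loop associated systems, where `y N M z y₀` starts at `y₀`. -/
structure Approximation (D : SPData U m n) where
  ψ : ℕ → E n → ℝ
  φ : ℕ → E m → ℝ
  ζ : ℕ → ℕ → E n → ℝ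
  η : ℕ → ℕ → D.Z → E m → ℝ
  u : ℕ → ℕ → D.Y → D.Z → U
  y : ℕ → ℕ → D.Z → D.Y → ℝ → D.Y
  ψ_total : IsC1Total ψ
  φ_total : IsC1Total φ
  ζ_sol : ∀ N ≥ 1, ∀ M ≥ 1, D.IsAvgDualSolution ψ φ N M (ζ N M)
  η_sol : ∀ N ≥ 1, ∀ M ≥ 1, ∀ z, D.IsAssocDualSolution φ M (ζ N M) z (η N M z)
  u_min : ∀ N ≥ 1, ∀ M ≥ 1, ∀ y z v,
    D.ham (ζ N M) (η N M z) (u N M y z) y z ≤ D.ham (ζ N M) (η N M z) v y z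
  y_sol : ∀ N ≥ 1, ∀ M ≥ 1, ∀ z y₀,
    D.IsUniqueClosedLoopSolution (fun y' => u N M y' z) z y₀ (y N M z y₀)

/-- The time average of `q` along a pair differs from the `μ`-mean of `q` by at most `b q S`. -/
def MeanEstimate {D : SPData U m n} (b : C(U × D.Y, ℝ) → ℝ → ℝ) (u : ℝ → U) (y : ℝ → D.Y)
    (μ : D.PUY) : Prop :=
  ∀ q : C(U × D.Y, ℝ), ∀ S > 0,
    |S⁻¹ * (∫ τ in (0 : ℝ)..S, q (u τ, y τ)) - ∫ w, q w ∂(μ : Measure (U × D.Y))| ≤ b q S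

namespace Approximation

variable {D : SPData U m n} (A : Approximation D)

/-- The control `τ ↦ u^{N,M}(y(τ), z)` along the closed-loop solution starting at `y₀`. -/
def ctrl (N M : ℕ) (z : D.Z) (y₀ : D.Y) (τ : ℝ) : U := A.u N M (A.y N M z y₀ τ) z

/-- First group of assumptions. Here `(μs, zs)` is the optimal pair of the averaged problem,
`(us t, ys t)` is the pair generating `μs t`, `yinit N M z` is the initial value of the member
`y_z^{N,M}` of the constructed family and `μNM N M z` is its occupational measure. -/
structure AssumptionOne (μs : ℝ → D.PUY) (zs : ℝ → D.Z) (us : ℝ → ℝ → U) (ys : ℝ → ℝ → D.Y)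
    (yinit : ℕ → ℕ → D.Z → D.Y) (μNM : ℕ → ℕ → D.Z → D.PUY) : Prop where
  unique_optimal : ∃! p, D.IsOptimalIDLP p
  values_eq : D.C * D.avgValue = D.idlpValue
  optimal_pair : D.IsOptimalPair μs zs
  regular : PiecewiseOneSidedContinuous μs
  assoc_pair : ∀ᵐ t ∂halfLine, D.AssocAdmissible (zs t) (us t) (ys t) ∧
    GeneratesOccupation (fun τ => (us t τ, ys t τ)) (μs t) ∧
    ∀ᵐ τ ∂halfLine, ∀ r > 0,
      0 < (μs t : Measure (U × D.Y)) {w | dist w.1 (us t τ) + dist w.2 (ys t τ) < r}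
  generates : ∀ N ≥ 1, ∀ M ≥ 1, ∀ z, GeneratesOccupation
    (fun τ => (A.ctrl N M z (yinit N M z) τ, A.y N M z (yinit N M z) τ)) (μNM N M z)
  measurable : ∀ N ≥ 1, ∀ M ≥ 1, ∀ q : C(U × D.Y, ℝ),
    Measurable fun z => ∫ w, q w ∂(μNM N M z : Measure (U × D.Y))
  /-- The mean estimate is uniform in `z`, `N` and `M`, and near the curve `ys t` the occupational
  measure does not depend on the initial value. -/
  estimate : ∃ b : C(U × D.Y, ℝ) → ℝ → ℝ, (∀ q, Tendsto (b q) atTop (𝓝 0)) ∧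
    (∀ N ≥ 1, ∀ M ≥ 1, ∀ z,
      MeanEstimate b (A.ctrl N M z (yinit N M z)) (A.y N M z (yinit N M z)) (μNM N M z)) ∧
    ∀ᵐ t ∂halfLine, ∀ N ≥ 1, ∀ M ≥ 1, ∃ O : Set D.Y, IsOpen O ∧ (∀ τ ≥ 0, ys t τ ∈ O) ∧
      ∀ y₀ ∈ O,
        GeneratesOccupation (fun τ => (A.ctrl N M (zs t) y₀ τ, A.y N M (zs t) y₀ τ))
          (μNM N M (zs t)) ∧
        MeanEstimate b (A.ctrl N M (zs t) y₀) (A.y N M (zs t) y₀) (μNM N M (zs t))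

/-- Second group of assumptions. The ball `Q_t` has centre `zs t` and radius `rQ t` (it is empty if
`rQ t ≤ 0`), `ρ` is built from the sequence `q`, and `zNM N M` is the trajectory `z^{N,M}`. -/
structure AssumptionTwo (q : ℕ → C(U × D.Y, ℝ)) (zs : ℝ → D.Z) (μNM : ℕ → ℕ → D.Z → D.PUY)
    (rQ : ℝ → ℝ) (zNM : ℕ → ℕ → ℝ → D.Z) : Prop where
  radius_pos : ∀ᵐ t ∂halfLine, 0 < rQ t
  continuity : ∀ᵐ t ∂halfLine, ∃ κ : ℝ → ℝ, Tendsto κ (𝓝[>] 0) (𝓝 0) ∧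
    ∀ N ≥ 1, ∀ M ≥ 1, ∀ z' ∈ Metric.ball (zs t) (rQ t), ∀ z'' ∈ Metric.ball (zs t) (rQ t),
      z' ≠ z'' → rho q (μNM N M z') (μNM N M z'') ≤ κ (dist z' z'')
  lipschitz : ∃ L : ℝ, ∀ᵐ t ∂halfLine,
    ∀ N ≥ 1, ∀ M ≥ 1, ∀ z' ∈ Metric.ball (zs t) (rQ t), ∀ z'' ∈ Metric.ball (zs t) (rQ t),
      ‖D.gTilde (μNM N M z') z' - D.gTilde (μNM N M z'') z''‖ ≤ L * dist z' z''
  solution : ∀ N ≥ 1, ∀ M ≥ 1, D.IsUniqueAvgFeedbackSolution (μNM N M) (zNM N M)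
  small_exit : ∀ t > 0, DoubleLimZero fun N M =>
    volume.real {t' ∈ Icc 0 t | zNM N M t' ∉ Metric.ball (zs t') (rQ t')}

/-- Third group of assumptions. The ball `B_{t,τ}` has centre `ys t τ` and radius `rB t τ`. -/
def AssumptionThree (zs : ℝ → D.Z) (ys : ℝ → ℝ → D.Y) (rQ : ℝ → ℝ) (rB : ℝ → ℝ → ℝ) : Prop :=
  ∀ᵐ t ∂halfLine, (Metric.ball (zs t) (rQ t)).Nonempty →
    (∀ᵐ τ ∂halfLine, 0 < rB t τ ∧ ∀ N ≥ 1, ∀ M ≥ 1,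
      ∀ y ∈ Metric.ball (ys t τ) (rB t τ), ∀ z ∈ Metric.ball (zs t) (rQ t), ∀ v : U,
        (∀ v', D.ham (A.ζ N M) (A.η N M z) v y z ≤ D.ham (A.ζ N M) (A.η N M z) v' y z) →
          v = A.u N M y z) ∧
    (∃ L : ℝ, ∀ᵐ τ ∂halfLine, ∀ N ≥ 1, ∀ M ≥ 1,
      ∀ y' ∈ Metric.ball (ys t τ) (rB t τ), ∀ z' ∈ Metric.ball (zs t) (rQ t),
      ∀ y'' ∈ Metric.ball (ys t τ) (rB t τ), ∀ z'' ∈ Metric.ball (zs t) (rQ t),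
        dist (A.u N M y' z') (A.u N M y'' z'') ≤ L * (dist y' y'' + dist z' z'')) ∧
    ∀ τ > 0, DoubleLimZero fun N M =>
      volume.real {τ' ∈ Icc 0 τ |
        A.y N M (zs t) (ys t 0) τ' ∉ Metric.ball (ys t τ') (rB t τ')}

end Approximation

end SPControl

end

set_option linter.unusedSectionVars false

noncomputable section

namespace SPControl

/-! Integration by parts shows that the discounted occupational measure of the optimal averaged pair
is feasible for the averaged IDLP problem. Since `C * avgValue = idlpValue`, it is optimal, hence it
is the unique optimal solution `p`. Weak compactness and uniqueness then show that an open set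
charged by `p` is charged by every minimizer of the `(N, M)`-problem once `N` and `M` are large
(`exists_forall_charges_of_unique`). By one-sided continuity of `μs`, every neighbourhood of `(μs t,
zs t)`, `t > 0`, is such a set.

Complementary slackness is used twice. In the averaged problem the dual inequality for `ζ` is an
equality almost everywhere for the minimizer, so arbitrarily near `(μs t, zs t)` there is a pair
`(μ, z)` in which `μ` minimizes `∫ (G + ∇ζᵀ g)` over `W_M(z)` (`exists_forall_exists_minimizer`). In
the associated problem, finite-dimensional duality shows that such a `μ` is carried by pairs `(u,
y)` in which `u` minimizes the Hamiltonian (`ae_ham_le`). Since `(us t τ, ys t τ)` lies in the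
support of `μs t`, one of these pairs is close to it. Uniqueness of the minimizer makes its control
component the value of the feedback at a nearby point, and the Lipschitz bound carries this over to
`(ys t τ, zs t)` (`eventually_dist_control_le`).

The rest is stability. Grönwall's inequality shows that the closed-loop trajectory from `ys t 0`
follows `ys t`. As the time-average estimate is uniform in `N` and `M`, the occupational measures at
`zs t` converge to `μs t` (`ae_tendsto_occupation`). A second Grönwall argument gives convergence of
the averaged trajectories, the moduli of continuity give convergence in `ρ`, and dominated
convergence gives convergence of the costs. The ACG property follows by compactness of `Z` from the
uniform estimates assumed for test functions on `U × Y`. -/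

/-! ### Iterated limits -/

/-- The filter on `ℕ × ℕ` of iterated limits: first `M → ∞`, then `N → ∞`. -/
abbrev iteratedAtTop : Filter (ℕ × ℕ) := (atTop : Filter ℕ).curry atTop

lemma eventually_iteratedAtTop_of_ge {p : ℕ × ℕ → Prop} (k : ℕ)
    (h : ∀ N ≥ k, ∀ M ≥ k, p (N, M)) : ∀ᶠ x in iteratedAtTop, p x := by
  rw [Filter.eventually_curry_iff]
  filter_upwards [eventually_ge_atTop k] with N hN
  filter_upwards [eventually_ge_atTop k] with M hM using h N hN M hM

lemma eventually_one_le_iteratedAtTop : ∀ᶠ p in iteratedAtTop, 1 ≤ p.1 ∧ 1 ≤ p.2 :=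
  eventually_iteratedAtTop_of_ge 1 fun _ hN _ hM => ⟨hN, hM⟩

/-- For nonnegative quantities the double upper limit is zero exactly when they tend to zero along
`iteratedAtTop`. This lemma and the ones below translate between the two, so that all estimates can
be made with one filter. -/
lemma doubleLimZero_of_eventually_le {a : ℕ → ℕ → ℝ} (ha : ∀ N ≥ 1, ∀ M ≥ 1, 0 ≤ a N M)
    (h : ∀ ε > 0, ∀ᶠ p in iteratedAtTop, a p.1 p.2 ≤ ε) : DoubleLimZero a := by
  have hnn : ∀ᶠ N in atTop, (0 : EReal) ≤ limsup (fun M => ((a N M : ℝ) : EReal)) atTop := by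
    filter_upwards [eventually_ge_atTop 1] with N hN
    refine le_limsup_of_frequently_le (Eventually.frequently ?_) (by isBoundedDefault)
    filter_upwards [eventually_ge_atTop 1] with M hM
    exact_mod_cast ha N hN M hM
  refine tendsto_order.2 ⟨fun b hb => ?_, fun b hb => ?_⟩
  · filter_upwards [hnn] with N hN using hb.trans_le hN
  · obtain ⟨ε, hε0, hεb⟩ := EReal.lt_iff_exists_real_btwn.1 hb
    have hε : (0 : ℝ) < ε := by exact_mod_cast hε0
    have := Filter.eventually_curry_iff.1 (h ε hε)
    filter_upwards [this] with N hN
    refine lt_of_le_of_lt (limsup_le_of_le (by isBoundedDefault) ?_) hεb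
    filter_upwards [hN] with M hM
    exact_mod_cast hM

lemma doubleLimZero_of_tendsto {a : ℕ → ℕ → ℝ} (ha : ∀ N ≥ 1, ∀ M ≥ 1, 0 ≤ a N M)
    (h : Tendsto (fun p : ℕ × ℕ => a p.1 p.2) iteratedAtTop (𝓝 0)) : DoubleLimZero a :=
  doubleLimZero_of_eventually_le ha fun ε hε =>
    ((tendsto_order.1 h).2 ε hε).mono fun _ h => le_of_lt h

lemma DoubleLimZero.eventually_lt {a : ℕ → ℕ → ℝ} (h : DoubleLimZero a) {ε : ℝ} (hε : 0 < ε) :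
    ∀ᶠ p in iteratedAtTop, a p.1 p.2 < ε := by
  rw [Filter.eventually_curry_iff]
  have hε' : (0 : EReal) < ε := by exact_mod_cast hε
  filter_upwards [(tendsto_order.1 h).2 _ hε'] with N hN
  filter_upwards [eventually_lt_of_limsup_lt hN] with M hM
  exact_mod_cast hM

lemma DoubleLimZero.tendsto {a : ℕ → ℕ → ℝ} (h : DoubleLimZero a) (ha : ∀ N M, 0 ≤ a N M) :
    Tendsto (fun p : ℕ × ℕ => a p.1 p.2) iteratedAtTop (𝓝 0) := by
  refine tendsto_order.2 ⟨fun b hb => ?_, fun b hb => h.eventually_lt hb⟩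
  exact Eventually.of_forall fun p => hb.trans_le (ha _ _)

/-! ### Dominated convergence for iterated limits -/

/-- The filter of iterated limits is not countably generated, so dominated convergence cannot be
applied to it directly. The reverse Fatou lemma handles `M`, and ordinary dominated convergence
applied to the upper limits in `M` handles `N`. -/
lemma tendsto_lintegral_iterated {α : Type*} [MeasurableSpace α] {ν : Measure α}
    [IsFiniteMeasure ν] {G : ℕ → ℕ → α → ENNReal} {B : NNReal}
    (hm : ∀ N M, Measurable (G N M)) (hB : ∀ N M a, G N M a ≤ B)
    (h : ∀ᵐ a ∂ν, Tendsto (fun p : ℕ × ℕ => G p.1 p.2 a) iteratedAtTop (𝓝 0)) :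
    Tendsto (fun p : ℕ × ℕ => ∫⁻ a, G p.1 p.2 a ∂ν) iteratedAtTop (𝓝 0) := by
  set H : ℕ → α → ENNReal := fun N a => limsup (fun M => G N M a) atTop with hH
  have hBfin : ∫⁻ _, (B : ENNReal) ∂ν ≠ ⊤ := by
    rw [lintegral_const]
    exact ENNReal.mul_ne_top ENNReal.coe_ne_top (measure_ne_top _ _)
  have hHm : ∀ N, Measurable (H N) := fun N => Measurable.limsup (hm N)
  have hHB : ∀ N a, H N a ≤ B := fun N a =>
    limsup_le_of_le (by isBoundedDefault) (Eventually.of_forall fun M => hB N M a)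
  have hH0 : Tendsto (fun N => ∫⁻ a, H N a ∂ν) atTop (𝓝 0) := by
    have := tendsto_lintegral_of_dominated_convergence (μ := ν) (F := H) (f := fun _ => 0)
      (fun _ => (B : ENNReal)) hHm (fun N => Eventually.of_forall (hHB N)) hBfin ?_
    · simpa using this
    filter_upwards [h] with a ha
    rw [ENNReal.tendsto_nhds_zero] at ha ⊢
    intro ε hε
    filter_upwards [Filter.eventually_curry_iff.1 (ha ε hε)] with N hN
    exact limsup_le_of_le (by isBoundedDefault) hN
  rw [ENNReal.tendsto_nhds_zero]
  intro ε hε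
  rw [Filter.eventually_curry_iff]
  filter_upwards [(tendsto_order.1 hH0).2 ε hε] with N hN
  have := limsup_lintegral_le (μ := ν) (fun _ => (B : ENNReal)) (hm N)
    (fun M => Eventually.of_forall (hB N M)) hBfin
  filter_upwards [eventually_lt_of_limsup_lt (this.trans_lt hN)] with M hM using hM.le

/-- The exceptional sets depend on the index and only their measures tend to zero, so convergence
need not hold pointwise. They contribute at most `B * ν.real (bad p)`, and dominated convergence
handles the integral off them. -/
lemma tendsto_integral_iterated {α : Type*} [MeasurableSpace α] {ν : Measure α}
    [IsFiniteMeasure ν] {F : ℕ × ℕ → α → ℝ} {bad : ℕ × ℕ → Set α} {B : ℝ}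
    (hm : ∀ p : ℕ × ℕ, 1 ≤ p.1 → 1 ≤ p.2 → AEMeasurable (F p) ν)
    (hB : ∀ p a, |F p a| ≤ B)
    (hbad : Tendsto (fun p => ν.real (bad p)) iteratedAtTop (𝓝 0))
    (h : ∀ᵐ a ∂ν, ∀ ε > 0, ∀ᶠ p in iteratedAtTop, a ∉ bad p → |F p a| ≤ ε) :
    Tendsto (fun p => ∫ a, |F p a| ∂ν) iteratedAtTop (𝓝 0) := by
  classical
  let B' : NNReal := Real.toNNReal B
  let F' : ℕ × ℕ → α → ℝ := fun p =>
    if hp : 1 ≤ p.1 ∧ 1 ≤ p.2 then (hm p hp.1 hp.2).mk else fun _ => 0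
  have hF'm : ∀ p, Measurable (F' p) := by
    intro p
    by_cases hp : 1 ≤ p.1 ∧ 1 ≤ p.2
    · simp only [F', dif_pos hp]; exact (hm p hp.1 hp.2).measurable_mk
    · simp only [F', dif_neg hp]; exact measurable_const
  have hF'e : ∀ p : ℕ × ℕ, 1 ≤ p.1 → 1 ≤ p.2 → F p =ᵐ[ν] F' p := by
    intro p h1 h2
    simp only [F', dif_pos (And.intro h1 h2)]
    exact (hm p h1 h2).ae_eq_mk
  have hF'e' : ∀ᵐ a ∂ν, ∀ p : ℕ × ℕ, 1 ≤ p.1 → 1 ≤ p.2 → F p a = F' p a := by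
    rw [ae_all_iff]; intro p
    by_cases hp : 1 ≤ p.1 ∧ 1 ≤ p.2
    · filter_upwards [hF'e p hp.1 hp.2] with a ha _ _ using ha
    · exact Eventually.of_forall fun a h1 h2 => absurd ⟨h1, h2⟩ hp
  -- The exceptional set need not be measurable, hence its measurable hull. The measurable version
  -- `F'` obeys the bound only almost everywhere, hence the truncation.
  let G : ℕ → ℕ → α → ENNReal := fun N M =>
    (toMeasurable ν (bad (N, M)))ᶜ.indicator
      (fun a => min (B' : ENNReal) (ENNReal.ofReal |F' (N, M) a|))
  have hG := tendsto_lintegral_iterated (ν := ν) (G := G) (B := B') ?_ ?_ ?_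
  rotate_left
  · intro N M
    refine Measurable.indicator ?_ (measurableSet_toMeasurable _ _).compl
    have := (hF'm (N, M))
    fun_prop
  · intro N M a
    simp only [G, indicator]
    split_ifs
    · exact min_le_left _ _
    · exact zero_le
  · filter_upwards [h, hF'e'] with a ha hae
    rw [ENNReal.tendsto_nhds_zero]
    intro ε hε
    obtain ⟨δ, hδ0, hδ⟩ : ∃ δ : ℝ, 0 < δ ∧ ENNReal.ofReal δ ≤ ε := by
      rcases eq_or_ne ε ⊤ with rfl | hne
      · exact ⟨1, one_pos, le_top⟩
      · exact ⟨ε.toReal, ENNReal.toReal_pos hε.ne' hne, by rw [ENNReal.ofReal_toReal hne]⟩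
    filter_upwards [ha δ hδ0, eventually_one_le_iteratedAtTop] with p hp h1
    simp only [G, indicator]
    split_ifs with hmem
    · refine (min_le_right _ _).trans (le_trans (ENNReal.ofReal_le_ofReal ?_) hδ)
      have : a ∉ bad p := fun hb => hmem (subset_toMeasurable _ _ hb)
      rw [← hae (p.1, p.2) h1.1 h1.2]
      exact hp this
    · exact zero_le
  have hG' : Tendsto (fun p : ℕ × ℕ => (∫⁻ a, G p.1 p.2 a ∂ν).toReal + B * ν.real (bad p))
      iteratedAtTop (𝓝 0) := by
    have h1 := (ENNReal.tendsto_toReal ENNReal.zero_ne_top).comp hG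
    have h2 := h1.add (hbad.const_mul B)
    simpa using h2
  refine squeeze_zero' (Eventually.of_forall fun p => integral_nonneg fun a => abs_nonneg _)
    ?_ hG'
  filter_upwards [eventually_one_le_iteratedAtTop] with p hp
  have hmp := hm p hp.1 hp.2
  have hlin : ∫⁻ a, ENNReal.ofReal |F p a| ∂ν ≤
      ∫⁻ a, G p.1 p.2 a ∂ν + ENNReal.ofReal B * ν (bad p) := by
    have hle : ∀ᵐ a ∂ν, ENNReal.ofReal |F p a| ≤ G p.1 p.2 a +
        (toMeasurable ν (bad p)).indicator (fun _ => ENNReal.ofReal B) a := by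
      filter_upwards [hF'e p hp.1 hp.2] with a ha
      have hFB : ENNReal.ofReal |F p a| ≤ ENNReal.ofReal B := ENNReal.ofReal_le_ofReal (hB p a)
      by_cases hmem : a ∈ toMeasurable ν (bad p)
      · simp [G, indicator, hmem, hFB]
      · simp only [G, indicator, mem_compl_iff, hmem, not_false_eq_true, if_true, if_false,
          add_zero, Prod.mk.eta]
        rw [← ha]
        exact le_min hFB le_rfl
    refine (lintegral_mono_ae hle).trans ?_
    rw [lintegral_add_right _ (measurable_const.indicator (measurableSet_toMeasurable _ _)),
      lintegral_indicator_const (measurableSet_toMeasurable _ _), measure_toMeasurable]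
  have hGfin : ∫⁻ a, G p.1 p.2 a ∂ν ≠ ⊤ := by
    refine ne_top_of_le_ne_top (b := ∫⁻ _, (B' : ENNReal) ∂ν) ?_ (lintegral_mono fun a => ?_)
    · rw [lintegral_const]
      exact ENNReal.mul_ne_top ENNReal.coe_ne_top (measure_ne_top _ _)
    · simp only [G, indicator]
      split_ifs
      · exact min_le_left _ _
      · exact zero_le
  rw [integral_eq_lintegral_of_nonneg_ae (Eventually.of_forall fun a => abs_nonneg _)
    (by simpa [Real.norm_eq_abs] using hmp.aestronglyMeasurable.norm)]
  have hBmul : ENNReal.ofReal B * ν (bad p) ≠ ⊤ :=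
    ENNReal.mul_ne_top ENNReal.ofReal_ne_top (measure_ne_top _ _)
  refine (ENNReal.toReal_mono (ENNReal.add_ne_top.2 ⟨hGfin, hBmul⟩) hlin).trans ?_
  rw [ENNReal.toReal_add hGfin hBmul, ENNReal.toReal_mul]
  -- Nonnegativity of `B` follows from the bound at a point, so the empty space is treated apart.
  rcases isEmpty_or_nonempty α with hα | ⟨⟨a⟩⟩
  · have : ν (bad p) = 0 := by rw [Set.eq_empty_of_isEmpty (bad p)]; simp
    simp [Measure.real, this]
  · have hB0 : 0 ≤ B := (abs_nonneg _).trans (hB p a)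
    rw [ENNReal.toReal_ofReal hB0, Measure.real]

/-! ### Absolutely continuous curves -/

lemma ae_halfLine_iff {P : ℝ → Prop} : (∀ᵐ t ∂halfLine, P t) ↔ ∀ᵐ t, 0 ≤ t → P t := by
  rw [ae_restrict_iff' measurableSet_Ici]; rfl

/-- A derivative is measurable, so velocities along trajectories need no separate measurability
argument. -/
lemma aemeasurable_of_ae_hasDerivAt {F : Type*} [NormedAddCommGroup F] [NormedSpace ℝ F]
    [CompleteSpace F] [MeasurableSpace F] [BorelSpace F] {x h : ℝ → F}
    (hd : ∀ᵐ t ∂halfLine, HasDerivAt x (h t) t) : AEMeasurable h halfLine :=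
  (measurable_deriv x).aemeasurable.congr (by filter_upwards [hd] with t ht using ht.deriv)

lemma intervalIntegrable_of_bound {F : Type*} [NormedAddCommGroup F] {h : ℝ → F} {B a b : ℝ}
    (ha : 0 ≤ a) (hb : 0 ≤ b) (hm : AEStronglyMeasurable h halfLine) (hB : ∀ t, ‖h t‖ ≤ B) :
    IntervalIntegrable h volume a b := by
  rw [intervalIntegrable_iff]
  have hsub : uIoc a b ⊆ Ici 0 := fun t ht => (le_min ha hb).trans ht.1.le
  have : IsFiniteMeasure (volume.restrict (uIoc a b)) := ⟨by simp [uIoc]⟩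
  exact Integrable.of_bound (hm.mono_measure (Measure.restrict_mono hsub le_rfl)) B
    (Eventually.of_forall hB)

/-- The primitive of the bounded function `h` is Lipschitz. Subtracting it from `x` leaves an
absolutely continuous curve with derivative zero almost everywhere, which is constant. -/
lemma integral_eq_sub_of_absolutelyContinuous {F : Type*} [NormedAddCommGroup F]
    [NormedSpace ℝ F] [CompleteSpace F] [MeasurableSpace F] [BorelSpace F]
    [SecondCountableTopology F] {x h : ℝ → F} {B : ℝ}
    (hx : ∀ T > 0, AbsolutelyContinuousOnInterval x 0 T)
    (hd : ∀ᵐ t ∂halfLine, HasDerivAt x (h t) t) (hB : ∀ t, ‖h t‖ ≤ B) {t : ℝ} (ht : 0 ≤ t) :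
    ∫ s in (0 : ℝ)..t, h s = x t - x 0 := by
  rcases ht.eq_or_lt with rfl | ht
  · simp
  have hm := (aemeasurable_of_ae_hasDerivAt hd).aestronglyMeasurable
  have hI : ∀ a b : ℝ, 0 ≤ a → 0 ≤ b → IntervalIntegrable h volume a b :=
    fun a b ha hb => intervalIntegrable_of_bound ha hb hm hB
  have hlip : LipschitzOnWith (Real.toNNReal B) (fun r => ∫ s in (0 : ℝ)..r, h s) (uIcc 0 t) := by
    refine LipschitzOnWith.of_dist_le_mul fun a ha b hb => ?_
    rw [uIcc_of_le ht.le] at ha hb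
    rw [dist_eq_norm, intervalIntegral.integral_interval_sub_left (hI _ _ le_rfl ha.1)
      (hI _ _ le_rfl hb.1), Real.dist_eq, Real.coe_toNNReal _ ((norm_nonneg _).trans (hB 0))]
    exact intervalIntegral.norm_integral_le_of_norm_le_const fun s _ => hB s
  have hac := (hx t ht).sub hlip.absolutelyContinuousOnInterval
  have hder : ∀ᵐ s, s ∈ uIcc 0 t →
      HasDerivAt (x - fun r => ∫ s in (0 : ℝ)..r, h s) 0 s := by
    filter_upwards [ae_halfLine_iff.1 hd,
      (hI 0 t le_rfl ht.le).ae_hasDerivAt_integral] with s hs1 hs2 hs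
    have h0 : 0 ≤ s := by rw [uIcc_of_le ht.le] at hs; exact hs.1
    have := (hs1 h0).sub (hs2 hs 0 (by simp))
    simpa using this
  obtain ⟨c, hc⟩ := hac.const_of_ae_hasDerivAt_zero hder
  have h0 := hc 0 (by simp)
  have h1 := hc t (by simp)
  simp only [Pi.sub_apply, intervalIntegral.integral_same, sub_zero] at h0 h1
  rw [h0, ← h1]; abel

/-- Grönwall's inequality in integral form. -/
lemma le_mul_exp_of_le_add_integral {w : ℝ → ℝ} {e K T : ℝ} (hK : 0 ≤ K)
    (hw : ContinuousOn w (Icc 0 T))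
    (h : ∀ t ∈ Icc 0 T, w t ≤ e + K * ∫ s in (0 : ℝ)..t, w s) :
    ∀ t ∈ Icc 0 T, w t ≤ e * Real.exp (K * t) := by
  have hI : ∀ t ∈ Icc 0 T, IntervalIntegrable w volume 0 t := fun t ht =>
    (hw.mono (by rw [uIcc_of_le ht.1]; exact Icc_subset_Icc_right ht.2)).intervalIntegrable
  have hder : ∀ t ∈ Ico 0 T,
      HasDerivWithinAt (fun t => e + K * ∫ s in (0 : ℝ)..t, w s) (K * w t) (Ici t) t := by
    intro t ht
    have hc : ContinuousWithinAt w (Ioi t) t :=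
      (hw t ⟨ht.1, ht.2.le⟩).mono_of_mem_nhdsWithin
        (mem_of_superset (Ioc_mem_nhdsGT ht.2) fun s hs => ⟨ht.1.trans hs.1.le, hs.2⟩)
    refine ((intervalIntegral.integral_hasDerivWithinAt_right (hI t ⟨ht.1, ht.2.le⟩)
      (s := Ici t) (t := Ioi t) ?_ hc).const_mul K).const_add e
    refine ⟨Ioc t T, Ioc_mem_nhdsGT ht.2, ?_⟩
    exact ((hw.mono fun s hs => ⟨ht.1.trans hs.1.le, hs.2⟩).aestronglyMeasurable
      measurableSet_Ioc)
  have hcont : ContinuousOn (fun t => e + K * ∫ s in (0 : ℝ)..t, w s) (Icc 0 T) := by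
    rcases le_or_gt 0 T with hT | hT
    · have := intervalIntegral.continuousOn_primitive_interval (μ := volume) (f := w) (a := 0)
        (b := T) (by rw [uIcc_of_le hT]; exact hw.integrableOn_Icc)
      rw [uIcc_of_le hT] at this
      exact continuousOn_const.add (continuousOn_const.mul this)
    · simp [Icc_eq_empty_of_lt hT]
  -- The differential form of Grönwall is applied to the majorant `e + K ∫ w`, which has a right
  -- derivative even though `w` need not have one.
  have key := le_gronwallBound_of_liminf_deriv_right_le (δ := e) (K := K) (ε := 0) hcont
    (fun t ht r hr => (hder t ht).liminf_right_slope_le hr) (by simp)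
    (fun t ht => by
      have := mul_le_mul_of_nonneg_left (h t ⟨ht.1, ht.2.le⟩) hK
      linarith)
  intro t ht
  refine (h t ht).trans ((key t ht).trans ?_)
  rw [gronwallBound_ε0, sub_zero]

/-- Two families of absolutely continuous curves with the same initial values stay close on bounded
intervals if, off small sets of times, their velocities differ little more than a multiple of their
distance. -/
lemma eventually_norm_sub_le_of_deriv_close {F : Type*} [NormedAddCommGroup F]
    [NormedSpace ℝ F] [CompleteSpace F] [MeasurableSpace F] [BorelSpace F]
    [SecondCountableTopology F] {x h : ℕ × ℕ → ℝ → F} {x₀ h₀ : ℝ → F} {K B : ℝ}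
    {bad : ℕ × ℕ → Set ℝ} (hK : 0 ≤ K)
    (hx : ∀ p : ℕ × ℕ, 1 ≤ p.1 → 1 ≤ p.2 →
      (∀ T > 0, AbsolutelyContinuousOnInterval (x p) 0 T) ∧
      (∀ᵐ t ∂halfLine, HasDerivAt (x p) (h p t) t) ∧ x p 0 = x₀ 0)
    (hB : ∀ p t, ‖h p t‖ ≤ B)
    (hx₀ : ∀ T > 0, AbsolutelyContinuousOnInterval x₀ 0 T)
    (hd₀ : ∀ᵐ t ∂halfLine, HasDerivAt x₀ (h₀ t) t) (hB₀ : ∀ t, ‖h₀ t‖ ≤ B)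
    (hbad : ∀ T > 0, Tendsto (fun p => volume.real (Icc 0 T ∩ bad p)) iteratedAtTop (𝓝 0))
    (hclose : ∀ᵐ t ∂halfLine, ∀ ε > 0, ∀ᶠ p in iteratedAtTop,
      t ∉ bad p → ‖h p t - h₀ t‖ ≤ K * ‖x p t - x₀ t‖ + ε)
    {T : ℝ} (hT : 0 < T) {ε : ℝ} (hε : 0 < ε) :
    ∀ᶠ p in iteratedAtTop, ∀ t ∈ Icc 0 T, ‖x p t - x₀ t‖ ≤ ε := by
  set ν : Measure ℝ := volume.restrict (Icc 0 T) with hν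
  have hνle : ν ≤ halfLine := Measure.restrict_mono (fun t ht => ht.1) le_rfl
  -- The defect of the Lipschitz estimate for the velocities. It is bounded by `B + B` and small off
  -- the exceptional sets, so its integral over `[0, T]` tends to zero and serves as the additive
  -- constant in Grönwall's inequality.
  let E : ℕ × ℕ → ℝ → ℝ := fun p t => max 0 (‖h p t - h₀ t‖ - K * ‖x p t - x₀ t‖)
  have hE0 : ∀ p t, 0 ≤ E p t := fun p t => le_max_left _ _
  have hEB : ∀ p t, |E p t| ≤ B + B := by
    intro p t
    rw [abs_of_nonneg (hE0 p t)]
    have h1 := (norm_sub_le (h p t) (h₀ t)).trans (add_le_add (hB p t) (hB₀ t))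
    have h2 : 0 ≤ K * ‖x p t - x₀ t‖ := by positivity
    exact max_le ((norm_nonneg _).trans h1) (by linarith)
  have hcont : ∀ p : ℕ × ℕ, 1 ≤ p.1 → 1 ≤ p.2 →
      ContinuousOn (fun t => ‖x p t - x₀ t‖) (Icc 0 T) := by
    intro p h1 h2
    have := (((hx p h1 h2).1 T hT).continuousOn.sub (hx₀ T hT).continuousOn).norm
    rwa [uIcc_of_le hT.le] at this
  have hEm : ∀ p : ℕ × ℕ, 1 ≤ p.1 → 1 ≤ p.2 → AEMeasurable (E p) ν := by
    intro p h1 h2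
    have m1 := (aemeasurable_of_ae_hasDerivAt (hx p h1 h2).2.1).mono_measure hνle
    have m2 := (aemeasurable_of_ae_hasDerivAt hd₀).mono_measure hνle
    have m3 := (hcont p h1 h2).aemeasurable (μ := volume) measurableSet_Icc
    exact aemeasurable_const.max ((m1.sub m2).norm.sub (m3.const_mul K))
  have hbad' : Tendsto (fun p => ν.real (bad p)) iteratedAtTop (𝓝 0) := by
    refine (hbad T hT).congr fun p => ?_
    rw [hν, measureReal_restrict_apply' measurableSet_Icc, inter_comm]
  have hint := tendsto_integral_iterated (ν := ν) hEm hEB hbad' (by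
    filter_upwards [ae_mono hνle hclose] with t ht δ hδ
    filter_upwards [ht δ hδ] with p hp hpt
    rw [abs_of_nonneg (hE0 p t)]
    exact max_le hδ.le (by linarith [hp hpt]))
  have hδ : 0 < ε / Real.exp (K * T) := by positivity
  filter_upwards [(tendsto_order.1 hint).2 _ hδ, eventually_one_le_iteratedAtTop] with p hp h1
  obtain ⟨hac, hd, h0⟩ := hx p h1.1 h1.2
  set e := ∫ t, |E p t| ∂ν with he
  have hm := (aemeasurable_of_ae_hasDerivAt hd).aestronglyMeasurable
  have hm₀ := (aemeasurable_of_ae_hasDerivAt hd₀).aestronglyMeasurable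
  have hEint : Integrable (fun t => |E p t|) ν :=
    Integrable.of_bound (hEm p h1.1 h1.2).abs.aestronglyMeasurable (B + B)
      (Eventually.of_forall fun t => by rw [Real.norm_eq_abs, abs_abs]; exact hEB p t)
  have hwle : ∀ t ∈ Icc 0 T, ‖x p t - x₀ t‖ ≤ e + K * ∫ s in (0 : ℝ)..t, ‖x p s - x₀ s‖ := by
    intro t ht
    have i1 := intervalIntegrable_of_bound le_rfl ht.1 hm (hB p)
    have i2 := intervalIntegrable_of_bound le_rfl ht.1 hm₀ hB₀
    have hEi : IntervalIntegrable (fun s => |E p s|) volume 0 t := by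
      rw [intervalIntegrable_iff, uIoc_of_le ht.1]
      exact IntegrableOn.mono_set hEint fun s hs => ⟨hs.1.le, hs.2.trans ht.2⟩
    have hwi : IntervalIntegrable (fun s => ‖x p s - x₀ s‖) volume 0 t :=
      ((hcont p h1.1 h1.2).mono
        (by rw [uIcc_of_le ht.1]; exact Icc_subset_Icc_right ht.2)).intervalIntegrable
    have heq : x p t - x₀ t = ∫ s in (0 : ℝ)..t, (h p s - h₀ s) := by
      rw [intervalIntegral.integral_sub i1 i2,
        integral_eq_sub_of_absolutelyContinuous hac hd (hB p) ht.1,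
        integral_eq_sub_of_absolutelyContinuous hx₀ hd₀ hB₀ ht.1, h0]
      abel
    calc ‖x p t - x₀ t‖ ≤ ∫ s in (0 : ℝ)..t, ‖h p s - h₀ s‖ := by
          rw [heq]; exact intervalIntegral.norm_integral_le_integral_norm ht.1
      _ ≤ ∫ s in (0 : ℝ)..t, (|E p s| + K * ‖x p s - x₀ s‖) := by
          refine intervalIntegral.integral_mono_on ht.1 (i1.sub i2).norm
            (hEi.add (hwi.const_mul K)) fun s _ => ?_
          have : ‖h p s - h₀ s‖ - K * ‖x p s - x₀ s‖ ≤ |E p s| :=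
            (le_max_right _ _).trans (le_abs_self _)
          linarith
      _ = (∫ s in (0 : ℝ)..t, |E p s|) + K * ∫ s in (0 : ℝ)..t, ‖x p s - x₀ s‖ := by
          rw [intervalIntegral.integral_add hEi (hwi.const_mul K),
            intervalIntegral.integral_const_mul]
      _ ≤ _ := by
          gcongr
          rw [intervalIntegral.integral_of_le ht.1, he]
          exact setIntegral_mono_set (μ := volume) hEint
            (Eventually.of_forall fun s => abs_nonneg _)
            (Eventually.of_forall fun s hs => ⟨hs.1.le, hs.2.trans ht.2⟩)
  intro t ht
  have hg := le_mul_exp_of_le_add_integral hK (hcont p h1.1 h1.2) hwle t ht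
  have he0 : 0 ≤ e := integral_nonneg fun _ => abs_nonneg _
  calc ‖x p t - x₀ t‖ ≤ e * Real.exp (K * t) := hg
    _ ≤ e * Real.exp (K * T) := by gcongr; exact ht.2
    _ ≤ ε / Real.exp (K * T) * Real.exp (K * T) := by gcongr
    _ = ε := by field_simp

/-! ### Spaces of probability measures -/

section Measures

variable {X : Type*} [TopologicalSpace X] [CompactSpace X] [MeasurableSpace X] [BorelSpace X]

lemma integrable_of_continuous {F : Type*} [NormedAddCommGroup F] {μ : Measure X}
    [IsFiniteMeasure μ] [SecondCountableTopologyEither X F] {f : X → F} (hf : Continuous f) :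
    Integrable f μ :=
  hf.integrable_of_hasCompactSupport (HasCompactSupport.of_compactSpace f)

lemma tendsto_probabilityMeasure_iff {ι : Type*} {l : Filter ι} {μs : ι → ProbabilityMeasure X}
    {μ : ProbabilityMeasure X} : Tendsto μs l (𝓝 μ) ↔
      ∀ q : C(X, ℝ), Tendsto (fun i => ∫ x, q x ∂(μs i : Measure X)) l
        (𝓝 (∫ x, q x ∂(μ : Measure X))) := by
  rw [ProbabilityMeasure.tendsto_iff_forall_integral_tendsto]
  exact ⟨fun h q => h (BoundedContinuousFunction.mkOfCompact q), fun h q => h q.toContinuousMap⟩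

lemma continuous_integral_probabilityMeasure (q : C(X, ℝ)) :
    Continuous fun μ : ProbabilityMeasure X => ∫ x, q x ∂(μ : Measure X) :=
  continuous_iff_continuousAt.2 fun _ => tendsto_probabilityMeasure_iff.1 tendsto_id q

lemma measurable_integral_probabilityMeasure (q : C(X, ℝ)) :
    Measurable fun μ : ProbabilityMeasure X => ∫ x, q x ∂(μ : Measure X) := by
  have heq : (fun μ : ProbabilityMeasure X => ∫ x, q x ∂(μ : Measure X)) =
      fun μ : ProbabilityMeasure X => (∫⁻ x, ENNReal.ofReal (q x) ∂(μ : Measure X)).toReal -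
        (∫⁻ x, ENNReal.ofReal (-q x) ∂(μ : Measure X)).toReal := by
    funext μ
    exact integral_eq_lintegral_pos_part_sub_lintegral_neg_part
      (integrable_of_continuous q.continuous)
  rw [heq]
  have hq : Measurable q := q.continuous.measurable
  exact ((Measure.measurable_lintegral hq.ennreal_ofReal).comp
      measurable_subtype_coe).ennreal_toReal.sub
    (((Measure.measurable_lintegral hq.neg.ennreal_ofReal)).comp
      measurable_subtype_coe).ennreal_toReal

omit [CompactSpace X] in
lemma lowerSemicontinuous_measure_isOpen [HasOuterApproxClosed X] {V : Set X} (hV : IsOpen V) :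
    LowerSemicontinuous fun μ : ProbabilityMeasure X => (μ : Measure X) V := by
  intro μ c hc
  exact eventually_lt_of_lt_liminf (hc.trans_le
    (ProbabilityMeasure.le_liminf_measure_open_of_tendsto (L := 𝓝 μ) tendsto_id hV))

-- The mass of the open complement is lower semicontinuous, so its zero set is closed. This gives
-- closed feasible sets and also makes "charges the open set `V`" an open condition on measures.
omit [CompactSpace X] in
lemma isClosed_setOf_ae_mem [HasOuterApproxClosed X] {K : Set X} (hK : IsClosed K) :
    IsClosed {μ : ProbabilityMeasure X | ∀ᵐ x ∂(μ : Measure X), x ∈ K} := by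
  have := (lowerSemicontinuous_measure_isOpen hK.isOpen_compl).isClosed_preimage 0
  convert this using 1
  ext μ
  simp [ae_iff, compl_def]

/-- The σ-algebra in use is generated by the evaluations `μ ↦ μ A`. Evaluations on open sets are
lower semicontinuous and open sets form a π-system, which gives one inclusion. For the other,
integrals of continuous functions are measurable and induce the weak topology. The result lets
continuous functions of `(μ, z)` be integrated. -/
instance borelSpace_probabilityMeasure [TopologicalSpace.MetrizableSpace X] :
    BorelSpace (ProbabilityMeasure X) := by
  set s : Set (Set (ProbabilityMeasure X)) :=
    {A | ∃ (q : C(X, ℝ)) (V : Set ℝ), IsOpen V ∧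
      A = (fun μ : ProbabilityMeasure X => ∫ x, q x ∂(μ : Measure X)) ⁻¹' V} with hs
  have htop : (inferInstance : TopologicalSpace (ProbabilityMeasure X)) =
      TopologicalSpace.generateFrom s := by
    refine le_antisymm (le_generateFrom ?_) ?_
    · rintro A ⟨q, V, hV, rfl⟩
      exact hV.preimage (continuous_integral_probabilityMeasure q)
    · refine le_of_nhds_le_nhds fun μ => ?_
      refine tendsto_id'.1 (tendsto_probabilityMeasure_iff.2 fun q => ?_)
      refine tendsto_nhds.2 fun V hV hμ => ?_
      have hmem : (fun μ : ProbabilityMeasure X => ∫ x, q x ∂(μ : Measure X)) ⁻¹' V ∈ s :=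
        ⟨q, V, hV, rfl⟩
      exact @IsOpen.mem_nhds _ (TopologicalSpace.generateFrom s) μ _
        (TopologicalSpace.isOpen_generateFrom_of_mem hmem) hμ
  constructor
  refine le_antisymm ?_ ?_
  · have : @Measurable _ _ (borel (ProbabilityMeasure X)) _
        (fun μ : ProbabilityMeasure X => (μ : Measure X)) := by
      let _ : MeasurableSpace (ProbabilityMeasure X) := borel _
      have : BorelSpace (ProbabilityMeasure X) := ⟨rfl⟩
      refine @Measurable.measure_of_isPiSystem_of_isProbabilityMeasure _ _ _ _
        (fun μ : ProbabilityMeasure X => (μ : Measure X)) _ {V : Set X | IsOpen V}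
        (by rw [BorelSpace.measurable_eq (α := X)]; rfl) isPiSystem_isOpen ?_
      intro V hV
      exact (lowerSemicontinuous_measure_isOpen hV).measurable
    exact this.comap_le
  -- Second countability of the weak topology lets the subbasis generate the Borel sets.
  · rw [borel_eq_generateFrom_of_subbasis htop]
    refine MeasurableSpace.generateFrom_le ?_
    rintro A ⟨q, V, hV, rfl⟩
    exact measurable_integral_probabilityMeasure q hV.measurableSet

lemma abs_integral_sub_le_norm (q q' : C(X, ℝ)) (μ : ProbabilityMeasure X) :
    |(∫ x, q x ∂(μ : Measure X)) - ∫ x, q' x ∂(μ : Measure X)| ≤ ‖q - q'‖ := by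
  rw [← integral_sub (integrable_of_continuous q.continuous)
    (integrable_of_continuous q'.continuous), ← Real.norm_eq_abs]
  have := norm_integral_le_of_norm_le_const (μ := (μ : Measure X)) (C := ‖q - q'‖)
    (Eventually.of_forall fun x => (q - q').norm_coe_le_norm x)
  simpa using this

/-- As `X` is compact, `z ↦ q(·, z)` is continuous into `C(X)` with the sup norm, so varying the
integrand costs little uniformly in the measure. -/
lemma continuous_integral_param {Z : Type*} [TopologicalSpace Z] {q : X → Z → ℝ}
    (hq : Continuous fun x : X × Z => q x.1 x.2) :
    Continuous fun x : ProbabilityMeasure X × Z => ∫ w, q w x.2 ∂(x.1 : Measure X) := by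
  let c : C(Z, C(X, ℝ)) := ContinuousMap.curry ⟨fun x : Z × X => q x.2 x.1, by fun_prop⟩
  refine continuous_iff_continuousAt.2 fun x₀ => ?_
  have h1 : Tendsto (fun x : ProbabilityMeasure X × Z =>
      ∫ w, c x₀.2 w ∂(x.1 : Measure X)) (𝓝 x₀) (𝓝 (∫ w, c x₀.2 w ∂(x₀.1 : Measure X))) :=
    ((continuous_integral_probabilityMeasure (c x₀.2)).comp continuous_fst).tendsto x₀
  have h2 : Tendsto (fun x : ProbabilityMeasure X × Z => ‖c x.2 - c x₀.2‖) (𝓝 x₀) (𝓝 0) := by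
    have : Continuous fun x : ProbabilityMeasure X × Z => ‖c x.2 - c x₀.2‖ := by fun_prop
    simpa using this.tendsto x₀
  have h3 : Tendsto (fun x : ProbabilityMeasure X × Z =>
      (∫ w, c x.2 w ∂(x.1 : Measure X)) - ∫ w, c x₀.2 w ∂(x.1 : Measure X)) (𝓝 x₀) (𝓝 0) :=
    squeeze_zero_norm (fun x => abs_integral_sub_le_norm _ _ _) h2
  have := h3.add h1
  simp only [sub_add_cancel, zero_add] at this
  exact this

lemma continuous_integral_param_euclidean {Z : Type*} [TopologicalSpace Z] {k : ℕ}
    [SecondCountableTopology X]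
    {q : X → Z → E k} (hq : Continuous fun x : X × Z => q x.1 x.2) :
    Continuous fun x : ProbabilityMeasure X × Z => ∫ w, q w x.2 ∂(x.1 : Measure X) := by
  have h : ∀ i, Continuous fun x : ProbabilityMeasure X × Z =>
      (∫ w, q w x.2 ∂(x.1 : Measure X)) i := by
    intro i
    have heq : ∀ x : ProbabilityMeasure X × Z, (∫ w, q w x.2 ∂(x.1 : Measure X)) i =
        ∫ w, q w x.2 i ∂(x.1 : Measure X) := by
      intro x
      exact ((EuclideanSpace.proj (𝕜 := ℝ) i).integral_comp_comm
        (integrable_of_continuous (by fun_prop))).symm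
    simp_rw [heq]
    exact continuous_integral_param (q := fun w z => q w z i) (by fun_prop)
  exact (PiLp.continuous_toLp 2 _).comp (continuous_pi h)

/-- Separate the two occurrences of `z`: the integral is continuous in the one inside `q` and
measurable in the one inside `μ`, hence jointly measurable. Then restrict to the diagonal. -/
lemma measurable_integral_param {Z : Type*} [TopologicalSpace Z]
    [TopologicalSpace.MetrizableSpace Z]
    [SecondCountableTopology Z] [MeasurableSpace Z] [BorelSpace Z]
    {μ : Z → ProbabilityMeasure X}
    (hμ : ∀ q : C(X, ℝ), Measurable fun z => ∫ w, q w ∂(μ z : Measure X))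
    {q : X → Z → ℝ} (hq : Continuous fun x : X × Z => q x.1 x.2) :
    Measurable fun z => ∫ w, q w z ∂(μ z : Measure X) := by
  have h : Measurable (Function.uncurry fun (z' z : Z) => ∫ w, q w z' ∂(μ z : Measure X)) := by
    refine measurable_uncurry_of_continuous_of_measurable (fun z => ?_) (fun z' => ?_)
    · exact (continuous_integral_param hq).comp (by fun_prop : Continuous fun z' : Z => (μ z, z'))
    · exact hμ ⟨fun w => q w z', by fun_prop⟩
  exact h.comp (measurable_id.prodMk measurable_id)

end Measures

/-! ### The metric `ρ` -/

section Rho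

variable {X : Type*} [PseudoMetricSpace X] [MeasurableSpace X] {q : ℕ → C(X, ℝ)}

lemma abs_integral_le_one {q : C(X, ℝ)} (hq : ∀ x, |q x| ≤ 1) (μ : ProbabilityMeasure X) :
    |∫ x, q x ∂(μ : Measure X)| ≤ 1 := by
  rw [← Real.norm_eq_abs]
  simpa using norm_integral_le_of_norm_le_const (μ := (μ : Measure X)) (f := q) (C := 1)
    (Eventually.of_forall hq)

lemma rho_term_le (hq : IsDenseLipschitzSeq q) (μ μ' : ProbabilityMeasure X) (l : ℕ) :
    (1 / 2 : ℝ) ^ (l + 1) * |(∫ w, q l w ∂(μ : Measure X)) - ∫ w, q l w ∂(μ' : Measure X)| ≤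
      (1 / 2 : ℝ) ^ l := by
  have h := (abs_sub _ _).trans (add_le_add (abs_integral_le_one (hq.2.1 l) μ)
    (abs_integral_le_one (hq.2.1 l) μ'))
  calc _ ≤ (1 / 2 : ℝ) ^ (l + 1) * (1 + 1) := by gcongr
    _ = _ := by rw [pow_succ]; ring

lemma rho_term_nonneg (q : ℕ → C(X, ℝ)) (μ μ' : ProbabilityMeasure X) (l : ℕ) :
    0 ≤ (1 / 2 : ℝ) ^ (l + 1) *
      |(∫ w, q l w ∂(μ : Measure X)) - ∫ w, q l w ∂(μ' : Measure X)| := by positivity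

lemma summable_rho (hq : IsDenseLipschitzSeq q) (μ μ' : ProbabilityMeasure X) :
    Summable fun l => (1 / 2 : ℝ) ^ (l + 1) *
      |(∫ w, q l w ∂(μ : Measure X)) - ∫ w, q l w ∂(μ' : Measure X)| :=
  Summable.of_nonneg_of_le (rho_term_nonneg q μ μ') (rho_term_le hq μ μ')
    summable_geometric_two

lemma rho_nonneg (q : ℕ → C(X, ℝ)) (μ μ' : ProbabilityMeasure X) : 0 ≤ rho q μ μ' :=
  tsum_nonneg (rho_term_nonneg q μ μ')

lemma rho_self (q : ℕ → C(X, ℝ)) (μ : ProbabilityMeasure X) : rho q μ μ = 0 := by simp [rho]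

lemma rho_triangle (hq : IsDenseLipschitzSeq q) (μ₁ μ₂ μ₃ : ProbabilityMeasure X) :
    rho q μ₁ μ₃ ≤ rho q μ₁ μ₂ + rho q μ₂ μ₃ := by
  unfold rho
  rw [← (summable_rho hq μ₁ μ₂).tsum_add (summable_rho hq μ₂ μ₃)]
  refine (summable_rho hq μ₁ μ₃).tsum_le_tsum (fun l => ?_)
    ((summable_rho hq μ₁ μ₂).add (summable_rho hq μ₂ μ₃))
  rw [← mul_add]
  gcongr
  exact abs_sub_le _ _ _

variable [CompactSpace X] [BorelSpace X]

lemma tendsto_rho_of_tendsto (hq : IsDenseLipschitzSeq q) {ι : Type*} {l : Filter ι}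
    {μs : ι → ProbabilityMeasure X} {μ : ProbabilityMeasure X} (h : Tendsto μs l (𝓝 μ)) :
    Tendsto (fun i => rho q (μs i) μ) l (𝓝 0) := by
  have := tendsto_tsum_of_dominated_convergence (𝓕 := l) (bound := fun l : ℕ => (1 / 2 : ℝ) ^ l)
    (f := fun i l => (1 / 2 : ℝ) ^ (l + 1) *
      |(∫ w, q l w ∂(μs i : Measure X)) - ∫ w, q l w ∂(μ : Measure X)|) (g := fun _ => 0)
    summable_geometric_two (fun k => ?_) (Eventually.of_forall fun i k => ?_)
  · simpa [rho] using this
  · have := ((tendsto_probabilityMeasure_iff.1 h (q k)).sub_const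
      (∫ w, q k w ∂(μ : Measure X))).abs.const_mul ((1 / 2 : ℝ) ^ (k + 1))
    simpa using this
  · rw [Real.norm_of_nonneg (rho_term_nonneg q _ _ _)]
    exact rho_term_le hq _ _ _

/-- Each term of the series is bounded by its sum, so the integrals of all `q k` converge. Density
extends this to the unit ball and scaling to all continuous functions. -/
lemma tendsto_of_tendsto_rho (hq : IsDenseLipschitzSeq q) {ι : Type*} {l : Filter ι}
    {μs : ι → ProbabilityMeasure X} {μ : ProbabilityMeasure X}
    (h : Tendsto (fun i => rho q (μs i) μ) l (𝓝 0)) : Tendsto μs l (𝓝 μ) := by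
  have hk : ∀ k, Tendsto (fun i => |(∫ x, q k x ∂(μs i : Measure X)) -
      ∫ x, q k x ∂(μ : Measure X)|) l (𝓝 0) := by
    intro k
    have h2 := h.const_mul ((2 : ℝ) ^ (k + 1))
    rw [mul_zero] at h2
    refine squeeze_zero (fun i => abs_nonneg _) (fun i => ?_) h2
    have := (summable_rho hq (μs i) μ).le_tsum k fun j _ => rho_term_nonneg q _ _ j
    calc _ = (2 : ℝ) ^ (k + 1) * ((1 / 2 : ℝ) ^ (k + 1) *
          |(∫ x, q k x ∂(μs i : Measure X)) - ∫ x, q k x ∂(μ : Measure X)|) := by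
          rw [← mul_assoc, ← mul_pow]; norm_num
      _ ≤ _ := by gcongr; exact this
  have hunit : ∀ f : C(X, ℝ), (∀ x, |f x| ≤ 1) →
      Tendsto (fun i => ∫ x, f x ∂(μs i : Measure X)) l (𝓝 (∫ x, f x ∂(μ : Measure X))) := by
    intro f hf
    rw [Metric.tendsto_nhds]
    intro ε hε
    obtain ⟨k, hkf⟩ := hq.2.2 f hf (ε / 4) (by linarith)
    have hn : ‖f - q k‖ ≤ ε / 4 :=
      (ContinuousMap.norm_le _ (by linarith)).2 fun x => (hkf x).le
    filter_upwards [(tendsto_order.1 (hk k)).2 (ε / 4) (by linarith)] with i hi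
    have h1 := abs_integral_sub_le_norm f (q k) (μs i)
    have h2 := abs_integral_sub_le_norm f (q k) μ
    rw [Real.dist_eq]
    rw [abs_lt] at hi ⊢
    rw [abs_le] at h1 h2
    constructor <;> linarith [h1.1, h1.2, h2.1, h2.2, hi.1, hi.2]
  refine tendsto_probabilityMeasure_iff.2 fun f => ?_
  set c : ℝ := ‖f‖ + 1 with hc
  have hc0 : 0 < c := by positivity
  have := (hunit (c⁻¹ • f) fun x => ?_).const_mul c
  · simpa [integral_const_mul, ← mul_assoc, mul_inv_cancel₀ hc0.ne'] using this
  · have hfx := f.norm_coe_le_norm x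
    rw [Real.norm_eq_abs] at hfx
    simp only [ContinuousMap.coe_smul, Pi.smul_apply, smul_eq_mul, abs_mul, abs_inv,
      abs_of_pos hc0]
    rw [inv_mul_le_iff₀ hc0]
    linarith

end Rho

/-! ### Averaged data: continuity, closed constraint graphs, passage from basis functions to all
test functions -/

variable {U : Type*} [MetricSpace U] [CompactSpace U] [MeasurableSpace U] [BorelSpace U]
  {m n : ℕ}

lemma fderiv_sum_range {k : ℕ} {ψ : ℕ → E k → ℝ} (hψ : ∀ i, ContDiff ℝ 1 (ψ i)) (N : ℕ)
    (c : ℕ → ℝ) (x : E k) :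
    fderiv ℝ (fun x => ∑ i ∈ Finset.range N, c i * ψ i x) x =
      ∑ i ∈ Finset.range N, c i • fderiv ℝ (ψ i) x := by
  have hd : ∀ i, DifferentiableAt ℝ (ψ i) x := fun i =>
    (hψ i).contDiffAt.differentiableAt one_ne_zero
  rw [fderiv_fun_sum fun i _ => (hd i).const_mul (c i)]
  exact Finset.sum_congr rfl fun i _ => fderiv_const_mul (hd i) (c i)

lemma contDiff_of_mem_firstSpan {k : ℕ} {ψ : ℕ → E k → ℝ} (hψ : ∀ i, ContDiff ℝ 1 (ψ i))
    {N : ℕ} {ζ : E k → ℝ} (hζ : ζ ∈ firstSpan ψ N) : ContDiff ℝ 1 ζ := by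
  obtain ⟨c, rfl⟩ := hζ
  exact ContDiff.sum fun i _ => contDiff_const.mul (hψ i)

namespace SPData

variable (D : SPData U m n)

instance compactSpace_Y : CompactSpace D.Y := isCompact_iff_compactSpace.1 D.Y_compact

instance compactSpace_Z : CompactSpace D.Z := isCompact_iff_compactSpace.1 D.Z_compact

lemma continuous_f : Continuous fun x : (U × D.Y) × D.Z => D.f x.1.1 x.1.2 x.2 :=
  D.f_cont.comp (f := fun x : (U × D.Y) × D.Z => (x.1.1, (x.1.2 : E m), (x.2 : E n)))
    (by fun_prop)

lemma continuous_g : Continuous fun x : (U × D.Y) × D.Z => D.g x.1.1 x.1.2 x.2 :=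
  D.g_cont.comp (f := fun x : (U × D.Y) × D.Z => (x.1.1, (x.1.2 : E m), (x.2 : E n)))
    (by fun_prop)

lemma continuous_G : Continuous fun x : (U × D.Y) × D.Z => D.G x.1.1 x.1.2 x.2 :=
  D.G_cont.comp (f := fun x : (U × D.Y) × D.Z => (x.1.1, (x.1.2 : E m), (x.2 : E n)))
    (by fun_prop)

lemma continuous_g_slice (z : D.Z) : Continuous fun w : U × D.Y => D.g w.1 w.2 z :=
  D.continuous_g.comp (f := fun w : U × D.Y => (w, z)) (by fun_prop)

lemma continuous_G_slice (z : D.Z) : Continuous fun w : U × D.Y => D.G w.1 w.2 z :=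
  D.continuous_G.comp (f := fun w : U × D.Y => (w, z)) (by fun_prop)

lemma continuous_fderiv_f {φ : E m → ℝ} (hφ : ContDiff ℝ 1 φ) :
    Continuous fun x : (U × D.Y) × D.Z => fderiv ℝ φ x.1.2 (D.f x.1.1 x.1.2 x.2) :=
  ((hφ.continuous_fderiv one_ne_zero).comp
    (f := fun x : (U × D.Y) × D.Z => (x.1.2 : E m)) (by fun_prop)).clm_apply D.continuous_f

lemma continuous_fderiv_f_slice {φ : E m → ℝ} (hφ : ContDiff ℝ 1 φ) (z : D.Z) :
    Continuous fun w : U × D.Y => fderiv ℝ φ w.2 (D.f w.1 w.2 z) :=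
  (D.continuous_fderiv_f hφ).comp (f := fun w : U × D.Y => (w, z)) (by fun_prop)

lemma exists_bound_f : ∃ B : ℝ, ∀ (u : U) (y : D.Y) (z : D.Z), ‖D.f u y z‖ ≤ B := by
  obtain ⟨B, hB⟩ := isCompact_univ.exists_bound_of_continuousOn D.continuous_f.continuousOn
  exact ⟨B, fun u y z => hB ((u, y), z) (mem_univ _)⟩

lemma continuous_gTilde : Continuous fun x : D.PUY × D.Z => D.gTilde x.1 x.2 :=
  continuous_integral_param_euclidean (q := fun (w : U × D.Y) (z : D.Z) => D.g w.1 w.2 z)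
    D.continuous_g

lemma continuous_GTilde : Continuous fun x : D.PUY × D.Z => D.GTilde x.1 x.2 :=
  continuous_integral_param (q := fun (w : U × D.Y) (z : D.Z) => D.G w.1 w.2 z)
    D.continuous_G

lemma exists_bound_gTilde : ∃ B : ℝ, ∀ (μ : D.PUY) (z : D.Z), ‖D.gTilde μ z‖ ≤ B := by
  obtain ⟨B, hB⟩ := isCompact_univ.exists_bound_of_continuousOn D.continuous_gTilde.continuousOn
  exact ⟨B, fun μ z => hB (μ, z) (mem_univ _)⟩

lemma exists_bound_GTilde : ∃ B : ℝ, ∀ (μ : D.PUY) (z : D.Z), |D.GTilde μ z| ≤ B := by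
  obtain ⟨B, hB⟩ := isCompact_univ.exists_bound_of_continuousOn D.continuous_GTilde.continuousOn
  exact ⟨B, fun μ z => hB (μ, z) (mem_univ _)⟩

lemma continuous_constraintFun {ψ : E n → ℝ} (hψ : ContDiff ℝ 1 ψ) :
    Continuous fun x : D.PUY × D.Z => D.constraintFun ψ x.1 x.2 := by
  have h1 : Continuous fun x : D.PUY × D.Z => fderiv ℝ ψ x.2 :=
    (hψ.continuous_fderiv one_ne_zero).comp (by fun_prop)
  have h2 : Continuous fun x : D.PUY × D.Z => ψ x.2 := hψ.continuous.comp (by fun_prop)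
  exact (h1.clm_apply D.continuous_gTilde).add
    (continuous_const.mul (continuous_const.sub h2))

lemma continuous_weakTerm {φ : E m → ℝ} (hφ : ContDiff ℝ 1 φ) :
    Continuous fun x : D.PUY × D.Z =>
      ∫ w, fderiv ℝ φ w.2 (D.f w.1 w.2 x.2) ∂(x.1 : Measure (U × D.Y)) :=
  continuous_integral_param
    (q := fun (w : U × D.Y) (z : D.Z) => fderiv ℝ φ w.2 (D.f w.1 w.2 z))
    (D.continuous_fderiv_f hφ)

lemma isClosed_graph_WM {φ : ℕ → E m → ℝ} (hφ : ∀ i, ContDiff ℝ 1 (φ i)) (M : ℕ) :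
    IsClosed {x : D.PUY × D.Z | x.1 ∈ D.WM φ M x.2} := by
  have : {x : D.PUY × D.Z | x.1 ∈ D.WM φ M x.2} = ⋂ i, ⋂ (_ : i < M), {x : D.PUY × D.Z |
      ∫ w, fderiv ℝ (φ i) w.2 (D.f w.1 w.2 x.2) ∂(x.1 : Measure (U × D.Y)) = 0} := by
    ext x; simp [WM]
  rw [this]
  exact isClosed_iInter fun i => isClosed_iInter fun _ =>
    isClosed_eq (D.continuous_weakTerm (hφ i)) continuous_const

lemma isClosed_graph_W : IsClosed {x : D.PUY × D.Z | x.1 ∈ D.W x.2} := by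
  have : {x : D.PUY × D.Z | x.1 ∈ D.W x.2} = ⋂ φ : E m → ℝ, ⋂ (_ : ContDiff ℝ 1 φ),
      {x : D.PUY × D.Z |
        ∫ w, fderiv ℝ φ w.2 (D.f w.1 w.2 x.2) ∂(x.1 : Measure (U × D.Y)) = 0} := by
    ext x; simp [W]
  rw [this]
  exact isClosed_iInter fun φ => isClosed_iInter fun hφ =>
    isClosed_eq (D.continuous_weakTerm hφ) continuous_const

lemma W_subset_WM {φ : ℕ → E m → ℝ} (hφ : ∀ i, ContDiff ℝ 1 (φ i)) (M : ℕ) (z : D.Z) :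
    D.W z ⊆ D.WM φ M z := fun _ hμ i _ => hμ _ (hφ i)

/-- Only the gradient of the test function enters, and it is approximated uniformly on `Y` by
gradients from the span, where the constraint holds by linearity. -/
lemma mem_W_of_forall_mem_WM {φ : ℕ → E m → ℝ} (hφ : IsC1Total φ) {z : D.Z} {μ : D.PUY}
    (h : ∀ M, μ ∈ D.WM φ M z) : μ ∈ D.W z := by
  intro ζ hζ
  obtain ⟨B, hB⟩ := D.exists_bound_f
  have hB' : ∀ w : U × D.Y, ‖D.f w.1 w.2 z‖ ≤ |B| + 1 := fun w =>
    (hB w.1 w.2 z).trans ((le_abs_self B).trans (by linarith))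
  have hB0 : 0 < |B| + 1 := by positivity
  refine abs_eq_zero.1 (le_antisymm (le_of_forall_pos_le_add fun ε hε => ?_) (abs_nonneg _))
  obtain ⟨N, c, hc⟩ := hφ.2 ζ hζ D.Y D.Y_compact (ε / (|B| + 1)) (by positivity)
  have hsum : ∫ w, (∑ i ∈ Finset.range N, c i • fderiv ℝ (φ i) w.2) (D.f w.1 w.2 z)
      ∂(μ : Measure (U × D.Y)) = 0 := by
    simp only [FunLike.coe_sum, FunLike.coe_smul, Finset.sum_apply, Pi.smul_apply, smul_eq_mul]
    rw [integral_finsetSum _ fun i _ =>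
      (integrable_of_continuous (D.continuous_fderiv_f_slice (hφ.1 i) z)).const_mul _]
    refine Finset.sum_eq_zero fun i hi => ?_
    rw [integral_const_mul, h N i (Finset.mem_range.1 hi), mul_zero]
  have hcs : Continuous fun w : U × D.Y =>
      (∑ i ∈ Finset.range N, c i • fderiv ℝ (φ i) w.2) (D.f w.1 w.2 z) := by
    simp only [FunLike.coe_sum, FunLike.coe_smul, Finset.sum_apply, Pi.smul_apply, smul_eq_mul]
    exact continuous_finsetSum _ fun i _ =>
      continuous_const.mul (D.continuous_fderiv_f_slice (hφ.1 i) z)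
  rw [zero_add, ← sub_zero (∫ w, fderiv ℝ ζ w.2 (D.f w.1 w.2 z) ∂(μ : Measure (U × D.Y))), ← hsum,
    ← integral_sub (integrable_of_continuous (D.continuous_fderiv_f_slice hζ z))
      (integrable_of_continuous hcs), ← Real.norm_eq_abs]
  have := norm_integral_le_of_norm_le_const (μ := (μ : Measure (U × D.Y))) (C := ε)
    (f := fun w => fderiv ℝ ζ w.2 (D.f w.1 w.2 z) -
      (∑ i ∈ Finset.range N, c i • fderiv ℝ (φ i) w.2) (D.f w.1 w.2 z))
    (Eventually.of_forall fun w => ?_)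
  · simpa using this
  · rw [← sub_apply]
    calc _ ≤ ‖fderiv ℝ ζ w.2 - ∑ i ∈ Finset.range N, c i • fderiv ℝ (φ i) w.2‖ *
          ‖D.f w.1 w.2 z‖ := ContinuousLinearMap.le_opNorm _ _
      _ ≤ ε / (|B| + 1) * (|B| + 1) := by
          gcongr
          · exact (hc w.2 w.2.2).2.le
          · exact hB' w
      _ = ε := by field_simp

lemma constraintFun_sum_range {ψ : ℕ → E n → ℝ} (hψ : ∀ i, ContDiff ℝ 1 (ψ i)) (N : ℕ)
    (c : ℕ → ℝ) (μ : D.PUY) (z : D.Z) :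
    D.constraintFun (fun x => ∑ i ∈ Finset.range N, c i * ψ i x) μ z =
      ∑ i ∈ Finset.range N, c i * D.constraintFun (ψ i) μ z := by
  unfold constraintFun
  rw [fderiv_sum_range hψ]
  simp only [FunLike.coe_sum, FunLike.coe_smul, Finset.sum_apply, Pi.smul_apply, smul_eq_mul,
    mul_add, Finset.sum_add_distrib, ← Finset.sum_sub_distrib, Finset.mul_sum]
  congr 1
  exact Finset.sum_congr rfl fun i _ => by ring

lemma integral_constraintFun_of_mem_firstSpan {ψ : ℕ → E n → ℝ}
    (hψ : ∀ i, ContDiff ℝ 1 (ψ i)) {N : ℕ} {ζ : E n → ℝ} (hζ : ζ ∈ firstSpan ψ N)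
    {p : ProbabilityMeasure (D.PUY × D.Z)}
    (hp : ∀ i < N, ∫ x, D.constraintFun (ψ i) x.1 x.2 ∂(p : Measure (D.PUY × D.Z)) = 0) :
    ∫ x, D.constraintFun ζ x.1 x.2 ∂(p : Measure (D.PUY × D.Z)) = 0 := by
  obtain ⟨c, rfl⟩ := hζ
  simp_rw [D.constraintFun_sum_range hψ]
  rw [integral_finsetSum _ fun i _ =>
    (integrable_of_continuous (D.continuous_constraintFun (hψ i))).const_mul _]
  refine Finset.sum_eq_zero fun i hi => ?_
  rw [integral_const_mul, hp i (Finset.mem_range.1 hi), mul_zero]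

lemma integral_constraintFun_eq_zero {ψ : ℕ → E n → ℝ} (hψ : IsC1Total ψ)
    {p : ProbabilityMeasure (D.PUY × D.Z)}
    (hp : ∀ i, ∫ x, D.constraintFun (ψ i) x.1 x.2 ∂(p : Measure (D.PUY × D.Z)) = 0)
    {ζ : E n → ℝ} (hζ : ContDiff ℝ 1 ζ) :
    ∫ x, D.constraintFun ζ x.1 x.2 ∂(p : Measure (D.PUY × D.Z)) = 0 := by
  obtain ⟨B, hB⟩ := D.exists_bound_gTilde
  have hC := D.C_pos
  -- The gradient error is multiplied by at most `|B|`, and the errors of the values at `z₀` and at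
  -- `z` by `C` each.
  set B' := |B| + 2 * D.C with hB'
  have hB0 : 0 < B' := by positivity
  refine abs_eq_zero.1 (le_antisymm (le_of_forall_pos_le_add fun ε hε => ?_) (abs_nonneg _))
  obtain ⟨N, c, hc⟩ := hψ.2 ζ hζ D.Z D.Z_compact (ε / B') (by positivity)
  set ζ' : E n → ℝ := fun x => ∑ i ∈ Finset.range N, c i * ψ i x with hζ'
  have hmem : ζ' ∈ firstSpan ψ N := ⟨c, rfl⟩
  have hζ'd := contDiff_of_mem_firstSpan hψ.1 hmem
  have hsum := D.integral_constraintFun_of_mem_firstSpan hψ.1 hmem fun i _ => hp i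
  rw [zero_add, ← sub_zero (∫ x, D.constraintFun ζ x.1 x.2 ∂(p : Measure (D.PUY × D.Z))), ← hsum,
    ← integral_sub (integrable_of_continuous (D.continuous_constraintFun hζ))
      (integrable_of_continuous (D.continuous_constraintFun hζ'd)), ← Real.norm_eq_abs]
  have := norm_integral_le_of_norm_le_const (μ := (p : Measure (D.PUY × D.Z))) (C := ε)
    (f := fun x => D.constraintFun ζ x.1 x.2 - D.constraintFun ζ' x.1 x.2)
    (Eventually.of_forall fun x => ?_)
  · simpa using this
  · have h1 := hc x.2 x.2.2
    have h0 := hc D.z₀ D.z₀.2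
    have e1 : |(fderiv ℝ ζ x.2 - fderiv ℝ ζ' x.2) (D.gTilde x.1 x.2)| ≤ ε / B' * |B| := by
      rw [← Real.norm_eq_abs]
      refine (ContinuousLinearMap.le_opNorm _ _).trans ?_
      gcongr
      · rw [hζ', fderiv_sum_range hψ.1]; exact h1.2.le
      · exact (hB _ _).trans (le_abs_self B)
    have e2 : |D.C * ((ζ D.z₀ - ζ' D.z₀) - (ζ x.2 - ζ' x.2))| ≤ D.C * (ε / B' + ε / B') := by
      rw [abs_mul, abs_of_pos hC]
      gcongr
      exact (abs_sub _ _).trans (add_le_add h0.1.le h1.1.le)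
    have e3 : D.constraintFun ζ x.1 x.2 - D.constraintFun ζ' x.1 x.2 =
        (fderiv ℝ ζ x.2 - fderiv ℝ ζ' x.2) (D.gTilde x.1 x.2) +
          D.C * ((ζ D.z₀ - ζ' D.z₀) - (ζ x.2 - ζ' x.2)) := by
      simp only [constraintFun, sub_apply]; ring
    rw [Real.norm_eq_abs, e3]
    calc _ ≤ ε / B' * |B| + D.C * (ε / B' + ε / B') := (abs_add_le _ _).trans (add_le_add e1 e2)
      _ = ε / B' * B' := by rw [hB']; ring
      _ = ε := by field_simp

/-! ### The infinite-dimensional linear programs -/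

lemma continuous_idlpCost : Continuous D.idlpCost :=
  continuous_integral_probabilityMeasure (X := D.PUY × D.Z) ⟨_, D.continuous_GTilde⟩

lemma isClosed_idlpFeasibleNM {ψ : ℕ → E n → ℝ} {φ : ℕ → E m → ℝ}
    (hψ : ∀ i, ContDiff ℝ 1 (ψ i)) (hφ : ∀ i, ContDiff ℝ 1 (φ i)) (N M : ℕ) :
    IsClosed (D.idlpFeasibleNM ψ φ N M) := by
  refine (isClosed_setOf_ae_mem (D.isClosed_graph_WM hφ M)).inter ?_
  have : {p : ProbabilityMeasure (D.PUY × D.Z) | ∀ i < N,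
      ∫ x, D.constraintFun (ψ i) x.1 x.2 ∂(p : Measure (D.PUY × D.Z)) = 0} =
      ⋂ i, ⋂ (_ : i < N), {p : ProbabilityMeasure (D.PUY × D.Z) |
        ∫ x, D.constraintFun (ψ i) x.1 x.2 ∂(p : Measure (D.PUY × D.Z)) = 0} := by
    ext p; simp
  change IsClosed {p : ProbabilityMeasure (D.PUY × D.Z) | ∀ i < N,
      ∫ x, D.constraintFun (ψ i) x.1 x.2 ∂(p : Measure (D.PUY × D.Z)) = 0}
  rw [this]
  exact isClosed_iInter fun i => isClosed_iInter fun _ => isClosed_eq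
    (continuous_integral_probabilityMeasure (X := D.PUY × D.Z)
      ⟨_, D.continuous_constraintFun (hψ i)⟩) continuous_const

lemma idlpFeasibleNM_anti (ψ : ℕ → E n → ℝ) (φ : ℕ → E m → ℝ) {N M N' M' : ℕ}
    (hN : N ≤ N') (hM : M ≤ M') : D.idlpFeasibleNM ψ φ N' M' ⊆ D.idlpFeasibleNM ψ φ N M := by
  rintro p ⟨h1, h2⟩
  refine ⟨?_, fun i hi => h2 i (hi.trans_le hN)⟩
  filter_upwards [h1] with x hx i hi using hx i (hi.trans_le hM)

lemma idlpFeasible_subset {ψ : ℕ → E n → ℝ} {φ : ℕ → E m → ℝ}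
    (hψ : ∀ i, ContDiff ℝ 1 (ψ i)) (hφ : ∀ i, ContDiff ℝ 1 (φ i)) (N M : ℕ) :
    D.idlpFeasible ⊆ D.idlpFeasibleNM ψ φ N M := by
  rintro p ⟨h1, h2⟩
  refine ⟨?_, fun i _ => h2 _ (hψ i)⟩
  filter_upwards [h1] with x hx using D.W_subset_WM hφ M _ hx

/-- The feasible sets decrease in both indices, so the diagonal problems already impose every
constraint. The `i`-th function first enters at `k = i + 1`. -/
lemma mem_idlpFeasible_of_forall {ψ : ℕ → E n → ℝ} {φ : ℕ → E m → ℝ} (hψ : IsC1Total ψ)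
    (hφ : IsC1Total φ) {p : ProbabilityMeasure (D.PUY × D.Z)}
    (h : ∀ k, p ∈ D.idlpFeasibleNM ψ φ k k) : p ∈ D.idlpFeasible := by
  refine ⟨?_, fun ζ hζ => D.integral_constraintFun_eq_zero hψ
    (fun i => (h (i + 1)).2 i (Nat.lt_succ_self i)) hζ⟩
  filter_upwards [ae_all_iff.2 fun k => (h k).1] with x hx
  exact D.mem_W_of_forall_mem_WM hφ hx

lemma bddBelow_idlpCost (S : Set (ProbabilityMeasure (D.PUY × D.Z))) :
    BddBelow (D.idlpCost '' S) := by
  obtain ⟨B, hB⟩ := (isCompact_univ.image D.continuous_idlpCost).bddBelow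
  exact ⟨B, fun c ⟨p, _, hp⟩ => hB ⟨p, mem_univ _, hp⟩⟩

lemma IsOptimalIDLP.cost_eq {D : SPData U m n} {p : ProbabilityMeasure (D.PUY × D.Z)}
    (hp : D.IsOptimalIDLP p) : D.idlpCost p = D.idlpValue :=
  le_antisymm (le_csInf ⟨_, p, hp.1, rfl⟩ (by rintro _ ⟨p', hp', rfl⟩; exact hp.2 p' hp'))
    (csInf_le (D.bddBelow_idlpCost _) ⟨p, hp.1, rfl⟩)

lemma isOptimalIDLP_of_cost_le {p : ProbabilityMeasure (D.PUY × D.Z)}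
    (hp : p ∈ D.idlpFeasible) (h : D.idlpCost p ≤ D.idlpValue) : D.IsOptimalIDLP p :=
  ⟨hp, fun p' hp' => h.trans (csInf_le (D.bddBelow_idlpCost _) ⟨p', hp', rfl⟩)⟩

/-- Feasible points of the approximating problems whose cost does not exceed the optimal value
charge every open set charged by the unique optimal solution. -/
lemma exists_forall_charges_of_unique {ψ : ℕ → E n → ℝ} {φ : ℕ → E m → ℝ} (hψ : IsC1Total ψ)
    (hφ : IsC1Total φ) {p : ProbabilityMeasure (D.PUY × D.Z)}
    (hu : ∀ p', D.IsOptimalIDLP p' → p' = p) {V : Set (D.PUY × D.Z)} (hV : IsOpen V)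
    (hpV : ¬ ∀ᵐ x ∂(p : Measure (D.PUY × D.Z)), x ∈ Vᶜ) :
    ∃ k, ∀ N ≥ k, ∀ M ≥ k, ∀ p' ∈ D.idlpFeasibleNM ψ φ N M, D.idlpCost p' ≤ D.idlpValue →
      ¬ ∀ᵐ x ∂(p' : Measure (D.PUY × D.Z)), x ∈ Vᶜ := by
  by_contra! hcon
  -- If the claim fails, these sets are nonempty, nested and compact. A common point would be
  -- feasible for the full problem with cost at most the optimal value, hence equal to `p`, although
  -- it does not charge `V`.
  let S : ℕ → Set (ProbabilityMeasure (D.PUY × D.Z)) := fun k =>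
    D.idlpFeasibleNM ψ φ k k ∩ ({p' | D.idlpCost p' ≤ D.idlpValue} ∩
      {p' | ∀ᵐ x ∂(p' : Measure (D.PUY × D.Z)), x ∈ Vᶜ})
  have hScl : ∀ k, IsClosed (S k) := fun k =>
    (D.isClosed_idlpFeasibleNM hψ.1 hφ.1 k k).inter
      ((isClosed_le D.continuous_idlpCost continuous_const).inter
        (isClosed_setOf_ae_mem hV.isClosed_compl))
  have hSne : ∀ k, (S k).Nonempty := by
    intro k
    obtain ⟨N, hN, M, hM, p', h1, h2, h3⟩ := hcon k
    exact ⟨p', D.idlpFeasibleNM_anti ψ φ hN hM h1, h2, h3⟩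
  obtain ⟨p', hp'⟩ := IsCompact.nonempty_iInter_of_sequence_nonempty_isCompact_isClosed S
    (fun k => inter_subset_inter_left _
      (D.idlpFeasibleNM_anti ψ φ (Nat.le_succ k) (Nat.le_succ k))) hSne
    (hScl 0).isCompact hScl
  rw [mem_iInter] at hp'
  have hfe := D.mem_idlpFeasible_of_forall hψ hφ fun k => (hp' k).1
  have := hu p' (D.isOptimalIDLP_of_cost_le hfe (hp' 0).2.1)
  exact hpV (this ▸ (hp' 0).2.2)

/-- Complementary slackness for the approximating averaged problems near a point charged by the
unique optimal solution. -/
lemma exists_forall_exists_minimizer {ψ : ℕ → E n → ℝ} {φ : ℕ → E m → ℝ} (hψ : IsC1Total ψ)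
    (hφ : IsC1Total φ) {p : ProbabilityMeasure (D.PUY × D.Z)} (hp : D.IsOptimalIDLP p)
    (hu : ∀ p', D.IsOptimalIDLP p' → p' = p) {V : Set (D.PUY × D.Z)} (hV : IsOpen V)
    (hpV : ¬ ∀ᵐ x ∂(p : Measure (D.PUY × D.Z)), x ∈ Vᶜ) :
    ∃ k, ∀ N ≥ k, ∀ M ≥ k, ∀ ζ, D.IsAvgDualSolution ψ φ N M ζ →
      ∃ x ∈ V, x.1 ∈ D.WM φ M x.2 ∧ ∀ μ ∈ D.WM φ M x.2,
        D.GTilde x.1 x.2 + fderiv ℝ ζ x.2 (D.gTilde x.1 x.2) ≤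
          D.GTilde μ x.2 + fderiv ℝ ζ x.2 (D.gTilde μ x.2) := by
  obtain ⟨k, hk⟩ := D.exists_forall_charges_of_unique hψ hφ hu hV hpV
  refine ⟨k, fun N hN M hM ζ hζ => ?_⟩
  have hpNM := D.idlpFeasible_subset hψ.1 hφ.1 N M hp.1
  obtain ⟨p', hp', hmin⟩ := (D.isClosed_idlpFeasibleNM hψ.1 hφ.1 N M).isCompact.exists_isMinOn
    ⟨p, hpNM⟩ D.continuous_idlpCost.continuousOn
  have hval : D.idlpValueNM ψ φ N M = D.idlpCost p' :=
    le_antisymm (csInf_le (D.bddBelow_idlpCost _) ⟨p', hp', rfl⟩)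
      (le_csInf ⟨_, p', hp', rfl⟩ (by rintro _ ⟨p'', hp'', rfl⟩; exact hmin hp''))
  -- Since `p` is feasible for the relaxed problem, the minimizer `p'` costs no more than the full
  -- optimal value.
  have hch := hk N hN M hM p' hp' (hp.cost_eq ▸ hmin hpNM)
  have hζd := contDiff_of_mem_firstSpan hψ.1 hζ.1
  have hint0 := D.integral_constraintFun_of_mem_firstSpan hψ.1 hζ.1 hp'.2
  have hcG : Integrable (fun x : D.PUY × D.Z => D.GTilde x.1 x.2) (p' : Measure _) :=
    integrable_of_continuous D.continuous_GTilde
  have hcζ : Integrable (fun x : D.PUY × D.Z => D.constraintFun ζ x.1 x.2) (p' : Measure _) :=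
    integrable_of_continuous (D.continuous_constraintFun hζd)
  -- The slack in the dual inequality is nonnegative. Its `p'`-integral is zero because the
  -- constraint term of `ζ` integrates to zero, so it vanishes almost everywhere.
  have hnn : 0 ≤ᵐ[(p' : Measure (D.PUY × D.Z))] fun x => D.GTilde x.1 x.2 +
      D.constraintFun ζ x.1 x.2 - D.idlpValueNM ψ φ N M := by
    filter_upwards [hp'.1] with x hx
    have := hζ.2 x.2 x.1 hx
    simp only [Pi.zero_apply, constraintFun]
    linarith
  have hzero : ∫ x, (D.GTilde x.1 x.2 + D.constraintFun ζ x.1 x.2 - D.idlpValueNM ψ φ N M)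
      ∂(p' : Measure (D.PUY × D.Z)) = 0 := by
    rw [integral_sub (f := fun x : D.PUY × D.Z => D.GTilde x.1 x.2 + D.constraintFun ζ x.1 x.2)
      (hcG.add hcζ) (integrable_const _), integral_add hcG hcζ, hint0, hval]
    simp [idlpCost]
  have hae := (integral_eq_zero_iff_of_nonneg_ae hnn
    ((hcG.add hcζ).sub (integrable_const _))).1 hzero
  have hfreq : ∃ᵐ x ∂(p' : Measure (D.PUY × D.Z)), x ∈ V := by
    intro h
    exact hch h
  obtain ⟨x, ⟨hxV, hxW⟩, hx⟩ := ((hfreq.and_eventually hp'.1).and_eventually hae).exists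
  refine ⟨x, hxV, hxW, fun μ hμ => ?_⟩
  -- Both measures are taken at the same `z`, so the terms `C (ζ(z₀) - ζ(z))` cancel.
  have := hζ.2 x.2 μ hμ
  simp only [Pi.zero_apply, constraintFun] at hx
  linarith

end SPData

/-! ### Duality for the associated problem -/

/-- Strong duality for linear programs over probability measures with finitely many moment
constraints. -/
lemma exists_forall_sub_le_add_sum {X : Type*} [TopologicalSpace X] [CompactSpace X]
    [T2Space X] [MeasurableSpace X] [BorelSpace X] (h : C(X, ℝ)) (c : ℕ → C(X, ℝ)) (M : ℕ)
    {μ₀ : ProbabilityMeasure X} (h₀ : ∀ i < M, ∫ x, c i x ∂(μ₀ : Measure X) = 0)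
    (hmin : ∀ μ : ProbabilityMeasure X, (∀ i < M, ∫ x, c i x ∂(μ : Measure X) = 0) →
      ∫ x, h x ∂(μ₀ : Measure X) ≤ ∫ x, h x ∂(μ : Measure X)) {ε : ℝ} (hε : 0 < ε) :
    ∃ b : ℕ → ℝ, ∀ x,
      (∫ x, h x ∂(μ₀ : Measure X)) - ε ≤ h x + ∑ i ∈ Finset.range M, b i * c i x := by
  classical
  set v := ∫ x, h x ∂(μ₀ : Measure X) with hv
  let F : ProbabilityMeasure X → ℝ × (Fin M → ℝ) := fun μ =>
    (∫ x, h x ∂(μ : Measure X), fun i => ∫ x, c i x ∂(μ : Measure X))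
  have hF : Continuous F := (continuous_integral_probabilityMeasure h).prodMk
    (continuous_pi fun i => continuous_integral_probabilityMeasure (c i))
  have hconv : Convex ℝ (range F) := by
    rintro _ ⟨μ, rfl⟩ _ ⟨ν, rfl⟩ a b ha hb hab
    have hprob : IsProbabilityMeasure
        (ENNReal.ofReal a • (μ : Measure X) + ENNReal.ofReal b • (ν : Measure X)) := by
      constructor
      simp [← ENNReal.ofReal_add ha hb, hab]
    have hI : ∀ q : C(X, ℝ), ∫ x, q x
        ∂(ENNReal.ofReal a • (μ : Measure X) + ENNReal.ofReal b • (ν : Measure X)) =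
        a * (∫ x, q x ∂(μ : Measure X)) + b * ∫ x, q x ∂(ν : Measure X) := by
      intro q
      rw [integral_add_measure
        ((integrable_of_continuous q.continuous).smul_measure ENNReal.ofReal_ne_top)
        ((integrable_of_continuous q.continuous).smul_measure ENNReal.ofReal_ne_top),
        integral_smul_measure, integral_smul_measure, ENNReal.toReal_ofReal ha,
        ENNReal.toReal_ofReal hb]
      rfl
    refine ⟨⟨_, hprob⟩, ?_⟩
    refine Prod.ext (hI h) (funext fun i => hI (c i))
  -- The moment set is compact and convex, and by optimality of `μ₀` it misses the closed half line
  -- of zero moments and cost at most `v - ε`. Strict separation yields the multipliers. The gap `ε`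
  -- replaces existence of an exact dual solution.
  have hdisj : Disjoint (range F) (Iic (v - ε) ×ˢ {(0 : Fin M → ℝ)}) := by
    rw [Set.disjoint_left]
    rintro _ ⟨μ, rfl⟩ ⟨h1, h2⟩
    have : v ≤ ∫ x, h x ∂(μ : Measure X) := hmin μ fun i hi => congrFun h2 ⟨i, hi⟩
    have h1' : ∫ x, h x ∂(μ : Measure X) ≤ v - ε := h1
    linarith
  obtain ⟨ℓ, s, t, hs, hst, ht⟩ := geometric_hahn_banach_compact_closed hconv
    (isCompact_range hF) ((convex_Iic _).prod (convex_singleton _))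
    (isClosed_Iic.prod isClosed_singleton) hdisj
  set α := ℓ (1, 0) with hα
  let β : Fin M → ℝ := fun i => ℓ (0, Pi.single i 1)
  have hℓ : ∀ (r : ℝ) (w : Fin M → ℝ), ℓ (r, w) = α * r + ∑ i, β i * w i := by
    intro r w
    have hw : ((r, w) : ℝ × (Fin M → ℝ)) =
        r • (1, 0) + ∑ i, w i • ((0, Pi.single i 1) : ℝ × (Fin M → ℝ)) := by
      refine Prod.ext (by simp [Prod.fst_sum]) ?_
      simp only [Prod.snd_add, Prod.smul_snd, smul_zero, Prod.snd_sum, zero_add]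
      exact pi_eq_sum_univ' w
    rw [hw, map_add, map_smul, map_sum, smul_eq_mul, mul_comm]
    congr 1
    exact Finset.sum_congr rfl fun i _ => by rw [map_smul, smul_eq_mul, mul_comm]
  have h1 : α * v < s := by
    have := hs (F μ₀) ⟨μ₀, rfl⟩
    have hz : (fun i : Fin M => ∫ x, c i x ∂(μ₀ : Measure X)) = 0 :=
      funext fun i => h₀ i i.2
    simp only [F, hz, hℓ] at this
    simpa using this
  have h2 : t < α * (v - ε) := by
    have := ht (v - ε, 0) ⟨mem_Iic.2 le_rfl, rfl⟩
    rw [hℓ] at this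
    simpa using this
  -- The separation puts `α * v` strictly below `α * (v - ε)`, so the cost coefficient is negative
  -- and one may divide by it.
  have hαneg : α < 0 := by
    by_contra hcon
    have : 0 ≤ α * ε := mul_nonneg (not_lt.1 hcon) hε.le
    linarith [mul_sub α v ε]
  refine ⟨fun i => if hi : i < M then β ⟨i, hi⟩ / α else 0, fun x => ?_⟩
  -- Testing the separating functional on a Dirac mass turns it into a pointwise inequality.
  let δ : ProbabilityMeasure X := ⟨Measure.dirac x, inferInstance⟩
  have h3 := hs (F δ) ⟨δ, rfl⟩
  have hδ : ∀ q : C(X, ℝ), ∫ y, q y ∂(δ : Measure X) = q x := fun q =>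
    integral_dirac' _ _ q.continuous.stronglyMeasurable
  simp only [F, hδ, hℓ] at h3
  rw [Finset.sum_range]
  have h4 : ∑ i : Fin M, (if hi : (i : ℕ) < M then β ⟨i, hi⟩ / α else 0) * c i x =
      (∑ i : Fin M, β i * c i x) / α := by
    rw [Finset.sum_div]
    exact Finset.sum_congr rfl fun i _ => by rw [dif_pos i.2]; simp only [Fin.eta]; ring
  rw [h4]
  have h5 : α * (h x + (∑ i : Fin M, β i * c i x) / α) < α * (v - ε) := by
    rw [mul_add, mul_div_cancel₀ _ hαneg.ne]
    linarith
  exact (lt_of_mul_lt_mul_of_nonpos_left h5 hαneg.le).le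

namespace SPData

variable (D : SPData U m n)

/-- A measure minimizing `∫ (G + ∇ζᵀ g)` over `W_M(z)` is concentrated on the pairs `(u, y)` for
which `u` minimizes the Hamiltonian of a solution of the associated dual problem. -/
lemma ae_ham_le {φ : ℕ → E m → ℝ} (hφ : ∀ i, ContDiff ℝ 1 (φ i)) {M : ℕ} {ζ : E n → ℝ}
    {η : E m → ℝ} {z : D.Z} {μ : D.PUY} (hμ : μ ∈ D.WM φ M z)
    (hmin : ∀ μ' ∈ D.WM φ M z, D.GTilde μ z + fderiv ℝ ζ z (D.gTilde μ z) ≤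
      D.GTilde μ' z + fderiv ℝ ζ z (D.gTilde μ' z))
    (hη : D.IsAssocDualSolution φ M ζ z η) :
    ∀ᵐ w ∂(μ : Measure (U × D.Y)), ∀ v, D.ham ζ η w.1 w.2 z ≤ D.ham ζ η v w.2 z := by
  let h : C(U × D.Y, ℝ) := ⟨fun w => D.G w.1 w.2 z + fderiv ℝ ζ z (D.g w.1 w.2 z),
    (D.continuous_G_slice z).add ((fderiv ℝ ζ z).continuous.comp (D.continuous_g_slice z))⟩
  let c : ℕ → C(U × D.Y, ℝ) := fun i =>
    ⟨fun w => fderiv ℝ (φ i) w.2 (D.f w.1 w.2 z), D.continuous_fderiv_f_slice (hφ i) z⟩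
  have hh : ∀ μ' : D.PUY, ∫ w, h w ∂(μ' : Measure (U × D.Y)) =
      D.GTilde μ' z + fderiv ℝ ζ z (D.gTilde μ' z) := by
    intro μ'
    change ∫ w : U × D.Y, (D.G w.1 w.2 z + fderiv ℝ ζ z (D.g w.1 w.2 z)) ∂(μ' : Measure _) = _
    rw [integral_add (integrable_of_continuous (D.continuous_G_slice z))
      (integrable_of_continuous
        ((fderiv ℝ ζ z).continuous.comp (D.continuous_g_slice z)) : Integrable
          (fun w : U × D.Y => fderiv ℝ ζ z (D.g w.1 w.2 z)) _),
      (fderiv ℝ ζ z).integral_comp_comm (integrable_of_continuous (D.continuous_g_slice z))]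
    rfl
  set v := ∫ w, h w ∂(μ : Measure (U × D.Y)) with hv
  have hham : ∀ (b : ℕ → ℝ) (w : U × D.Y),
      D.ham ζ (fun y => ∑ i ∈ Finset.range M, b i * φ i y) w.1 w.2 z =
        h w + ∑ i ∈ Finset.range M, b i * c i w := by
    intro b w
    unfold ham
    rw [fderiv_sum_range hφ]
    simp [h, c]
  -- Strong duality makes the dual value at least `v - ε` for every `ε > 0`, and `η` attains the
  -- dual value.
  have hge : ∀ w : U × D.Y, v ≤ D.ham ζ η w.1 w.2 z := by
    intro w
    refine le_of_forall_pos_le_add fun ε hε => ?_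
    obtain ⟨b, hb⟩ := exists_forall_sub_le_add_sum h c M hμ
      (fun μ' hμ' => by rw [hh, hh]; exact hmin μ' hμ') hε
    have h1 : ((v - ε : ℝ) : EReal) ≤ D.assocDualValue φ M ζ z :=
      le_sSup ⟨v - ε, rfl, _, ⟨b, rfl⟩, fun u y => by
        rw [hham b (u, y)]; exact hb (u, y)⟩
    have h2 := h1.trans (hη.2 w.1 w.2)
    have h3 : v - ε ≤ D.ham ζ η w.1 w.2 z := by exact_mod_cast h2
    linarith
  obtain ⟨b, hb⟩ := hη.1
  have hcont : Continuous fun w : U × D.Y => h w + ∑ i ∈ Finset.range M, b i * c i w :=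
    h.continuous.add (continuous_finsetSum _ fun i _ => continuous_const.mul (c i).continuous)
  have heqfun : ∀ w : U × D.Y, D.ham ζ η w.1 w.2 z =
      h w + ∑ i ∈ Finset.range M, b i * c i w := by rw [hb]; exact hham b
  have hIh : Integrable h (μ : Measure (U × D.Y)) := integrable_of_continuous h.continuous
  have hIc : ∀ i, Integrable (c i) (μ : Measure (U × D.Y)) := fun i =>
    integrable_of_continuous (c i).continuous
  -- The gradient terms of `η` have zero mean because `μ ∈ W_M(z)`. So the Hamiltonian has mean `v`,
  -- equal to its lower bound, and it equals `v` almost everywhere.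
  have hint : ∫ w : U × D.Y, (D.ham ζ η w.1 w.2 z - v) ∂(μ : Measure (U × D.Y)) = 0 := by
    simp_rw [heqfun]
    rw [integral_sub (integrable_of_continuous hcont) (integrable_const _),
      integral_add hIh (integrable_finsetSum _ fun i _ => (hIc i).const_mul _),
      integral_finsetSum _ fun i _ => (hIc i).const_mul _,
      Finset.sum_eq_zero fun i hi => by
        rw [integral_const_mul]
        exact mul_eq_zero_of_right _ (hμ i (Finset.mem_range.1 hi))]
    simp [hv]
  have hInt : Integrable (fun w : U × D.Y => D.ham ζ η w.1 w.2 z - v)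
      (μ : Measure (U × D.Y)) := by
    simp_rw [heqfun]
    exact (integrable_of_continuous hcont).sub (integrable_const _)
  have hae := (integral_eq_zero_iff_of_nonneg (fun w => sub_nonneg.2 (hge w)) hInt).1 hint
  filter_upwards [hae] with w hw u
  have h1 : D.ham ζ η w.1 w.2 z - v = 0 := hw
  have := hge (u, w.2)
  simp only at this
  linarith

end SPData

/-! ### The discounted occupational measure -/

/-- The probability measure on `[0, ∞)` with density `C e^{-Ct}`. -/
def discountMeasure (C : ℝ) : Measure ℝ :=
  halfLine.withDensity fun t => ((C * Real.exp (-C * t)).toNNReal : ENNReal)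

lemma measurable_discountDensity (C : ℝ) :
    Measurable fun t : ℝ => (C * Real.exp (-C * t)).toNNReal := by fun_prop

lemma integral_discountMeasure {C : ℝ} (hC : 0 < C) (F : ℝ → ℝ) :
    ∫ t, F t ∂(discountMeasure C) = C * ∫ t in Ioi (0 : ℝ), Real.exp (-C * t) * F t := by
  rw [discountMeasure, integral_withDensity_eq_integral_smul (measurable_discountDensity C),
    ← integral_const_mul, halfLine, integral_Ici_eq_integral_Ioi]
  congr 1
  funext t
  rw [NNReal.smul_def, Real.coe_toNNReal _ (by positivity), smul_eq_mul, mul_assoc]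

lemma integrableOn_exp_neg_mul {C : ℝ} (hC : 0 < C) :
    IntegrableOn (fun t => Real.exp (-C * t)) (Ioi 0) :=
  integrableOn_exp_mul_Ioi (neg_lt_zero.2 hC) 0

lemma isProbabilityMeasure_discountMeasure {C : ℝ} (hC : 0 < C) :
    IsProbabilityMeasure (discountMeasure C) := by
  constructor
  have hint : ∫ t in Ioi (0 : ℝ), C * Real.exp (-C * t) = 1 := by
    rw [integral_const_mul, integral_exp_mul_Ioi (neg_lt_zero.2 hC)]
    simp; field_simp
  have := ofReal_integral_eq_lintegral_ofReal (μ := volume.restrict (Ioi (0 : ℝ)))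
    ((integrableOn_exp_neg_mul hC).const_mul C) (Eventually.of_forall fun t => by positivity)
  rw [discountMeasure, withDensity_apply _ MeasurableSet.univ, Measure.restrict_univ, halfLine,
    restrict_Ioi_eq_restrict_Ici.symm]
  rw [hint, ENNReal.ofReal_one] at this
  exact this.symm

lemma ae_discountMeasure_of_ae {C : ℝ} {P : ℝ → Prop} (h : ∀ᵐ t ∂halfLine, P t) :
    ∀ᵐ t ∂(discountMeasure C), P t :=
  (withDensity_absolutelyContinuous _ _).ae_le h

/-- The density `C e^{-Ct}` is positive, so the two measures have the same null sets. -/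
lemma ae_of_ae_discountMeasure {C : ℝ} (hC : 0 < C) {P : ℝ → Prop}
    (h : ∀ᵐ t ∂(discountMeasure C), P t) : ∀ᵐ t ∂halfLine, P t := by
  refine (withDensity_absolutelyContinuous' ?_ ?_).ae_le h
  · exact (measurable_discountDensity C).coe_nnreal_ennreal.aemeasurable
  · refine Eventually.of_forall fun t => ?_
    simp only [ne_eq, ENNReal.coe_eq_zero, Real.toNNReal_eq_zero, not_le]
    positivity

lemma continuousOn_Ici_of_absolutelyContinuous {F : Type*} [NormedAddCommGroup F] {x : ℝ → F}
    (hx : ∀ T > 0, AbsolutelyContinuousOnInterval x 0 T) : ContinuousOn x (Ici 0) := by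
  intro t ht
  have ht' : (0 : ℝ) ≤ t := ht
  obtain ⟨T, hT⟩ := exists_gt t
  have hcont := (hx T (ht'.trans_lt hT)).continuousOn
  rw [uIcc_of_le (ht'.trans hT.le)] at hcont
  refine (hcont t (mem_Icc.2 ⟨ht', hT.le⟩)).mono_of_mem_nhdsWithin ?_
  rw [← Ici_inter_Iic]
  exact inter_mem_nhdsWithin _ (Iic_mem_nhds hT)

namespace SPData

variable (D : SPData U m n)

lemma continuousOn_of_absolutelyContinuous {z : ℝ → D.Z}
    (hz : ∀ T > 0, AbsolutelyContinuousOnInterval (fun t => (z t : E n)) 0 T) :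
    ContinuousOn z (Ici 0) :=
  IsInducing.subtypeVal.continuousOn_iff.2 (continuousOn_Ici_of_absolutelyContinuous hz)

variable {D}

lemma AvgAdmissible.aemeasurable_pair {μ : ℝ → D.PUY} {z : ℝ → D.Z}
    (h : D.AvgAdmissible μ z) : AEMeasurable (fun t => (μ t, z t)) halfLine :=
  h.1.prodMk ((D.continuousOn_of_absolutelyContinuous h.2.1).aemeasurable measurableSet_Ici)

/-- The velocity is bounded, so `z` is Lipschitz. As `Z` need not be convex, the Lipschitz constant
of `ψ` is taken on a ball containing `Z`. -/
lemma AvgAdmissible.lipschitzOnWith_comp {μ : ℝ → D.PUY} {z : ℝ → D.Z}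
    (h : D.AvgAdmissible μ z) {ψ : E n → ℝ} (hψ : ContDiff ℝ 1 ψ) :
    ∃ K, LipschitzOnWith K (fun t => ψ (z t)) (Ici 0) := by
  obtain ⟨B, hB⟩ := D.exists_bound_gTilde
  have hd : ∀ᵐ t ∂halfLine, HasDerivAt (fun s => (z s : E n)) (D.gTilde (μ t) (z t)) t := by
    filter_upwards [h.2.2] with t ht using ht.2
  have hlip : LipschitzOnWith (Real.toNNReal B) (fun t => (z t : E n)) (Ici 0) := by
    refine LipschitzOnWith.of_dist_le_mul fun a ha b hb => ?_
    have hm := (aemeasurable_of_ae_hasDerivAt hd).aestronglyMeasurable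
    have e1 := integral_eq_sub_of_absolutelyContinuous h.2.1 hd (fun t => hB _ _) ha
    have e2 := integral_eq_sub_of_absolutelyContinuous h.2.1 hd (fun t => hB _ _) hb
    have e3 : (z a : E n) - z b = ∫ s in b..a, D.gTilde (μ s) (z s) := by
      rw [← intervalIntegral.integral_interval_sub_left
        (intervalIntegrable_of_bound le_rfl ha hm fun t => hB _ _)
        (intervalIntegrable_of_bound le_rfl hb hm fun t => hB _ _), e1, e2]
      abel
    rw [dist_eq_norm, e3, Real.dist_eq, Real.coe_toNNReal _ ((norm_nonneg _).trans
      (hB (μ 0) (z 0)))]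
    exact intervalIntegral.norm_integral_le_of_norm_le_const fun s _ => hB _ _
  obtain ⟨R, hR⟩ := D.Z_compact.isBounded.subset_closedBall 0
  obtain ⟨K, hK⟩ := hψ.contDiffOn.exists_lipschitzOnWith one_ne_zero
    (convex_closedBall (0 : E n) R) (isCompact_closedBall _ _)
  exact ⟨_, hK.comp hlip fun t _ => hR (z t).2⟩

/-- Integration by parts: the discounted occupational measure of an admissible pair satisfies the
constraints of the averaged IDLP problem. -/
lemma AvgAdmissible.integral_exp_mul_constraintFun {μ : ℝ → D.PUY} {z : ℝ → D.Z}
    (h : D.AvgAdmissible μ z) (h0 : z 0 = D.z₀) {ψ : E n → ℝ} (hψ : ContDiff ℝ 1 ψ) :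
    ∫ t in Ioi (0 : ℝ), Real.exp (-D.C * t) * D.constraintFun ψ (μ t) (z t) = 0 := by
  have hC := D.C_pos
  -- The derivative of `F` is the integrand, `F` vanishes at `0` and, by boundedness of `ψ` on `Z`,
  -- at infinity.
  set F : ℝ → ℝ := fun t => Real.exp (-D.C * t) * (ψ (z t) - ψ D.z₀) with hF
  obtain ⟨K, hK⟩ := h.lipschitzOnWith_comp hψ
  have hder : ∀ᵐ t ∂halfLine,
      HasDerivAt F (Real.exp (-D.C * t) * D.constraintFun ψ (μ t) (z t)) t := by
    filter_upwards [h.2.2] with t ht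
    have h1 : HasDerivAt (fun s => ψ (z s)) (fderiv ℝ ψ (z t) (D.gTilde (μ t) (z t))) t :=
      ((hψ.contDiffAt.differentiableAt one_ne_zero).hasFDerivAt (x := (z t : E n))).comp_hasDerivAt
        t ht.2
    have h2 : HasDerivAt (fun s => Real.exp (-D.C * s)) (Real.exp (-D.C * t) * (-D.C)) t := by
      simpa using ((hasDerivAt_id t).const_mul (-D.C)).exp
    have := h2.mul (h1.sub_const (ψ D.z₀))
    refine this.congr_deriv ?_
    simp only [constraintFun]; ring
  have hac : ∀ T > 0, AbsolutelyContinuousOnInterval F 0 T := by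
    intro T hT
    have e1 : AbsolutelyContinuousOnInterval (fun s => Real.exp (-D.C * s)) 0 T :=
      ContDiffOn.absolutelyContinuousOnInterval (ContDiff.contDiffOn (by fun_prop))
    have e2 : AbsolutelyContinuousOnInterval (fun s => ψ (z s) - ψ D.z₀) 0 T := by
      refine LipschitzOnWith.absolutelyContinuousOnInterval (K := K) ?_
      refine LipschitzOnWith.of_dist_le_mul fun a ha b hb => ?_
      rw [uIcc_of_le hT.le] at ha hb
      rw [dist_sub_right]
      exact hK.dist_le_mul a ha.1 b hb.1
    exact e1.mul e2
  obtain ⟨B, hB⟩ := isCompact_univ.exists_bound_of_continuousOn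
    (D.continuous_constraintFun hψ).continuousOn
  have hm : AEStronglyMeasurable (fun t => D.constraintFun ψ (μ t) (z t)) halfLine :=
    ((D.continuous_constraintFun hψ).measurable.comp_aemeasurable
      h.aemeasurable_pair).aestronglyMeasurable
  have hint : IntegrableOn (fun t => Real.exp (-D.C * t) * D.constraintFun ψ (μ t) (z t))
      (Ioi 0) := by
    refine (integrableOn_exp_neg_mul hC).mul_bdd (c := B) ?_
      (Eventually.of_forall fun t => hB (μ t, z t) (mem_univ _))
    exact hm.mono_measure (Measure.restrict_mono Ioi_subset_Ici_self le_rfl)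
  have hlim := intervalIntegral_tendsto_integral_Ioi (0 : ℝ) hint tendsto_id
  have heq : ∀ᶠ T in atTop, (∫ t in (0 : ℝ)..id T,
      Real.exp (-D.C * t) * D.constraintFun ψ (μ t) (z t)) = F T := by
    filter_upwards [eventually_gt_atTop 0] with T hT
    have e1 := (hac T hT).integral_deriv_eq_sub
    have e2 : F 0 = 0 := by simp [hF, h0]
    rw [e2, sub_zero] at e1
    rw [← e1]
    refine intervalIntegral.integral_congr_ae ?_
    filter_upwards [ae_halfLine_iff.1 hder] with t ht hmem
    rw [id, uIoc_of_le hT.le] at hmem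
    exact (ht hmem.1.le).deriv.symm
  have hF0 : Tendsto F atTop (𝓝 0) := by
    obtain ⟨B', hB'⟩ := D.Z_compact.exists_bound_of_continuousOn hψ.continuous.continuousOn
    have h1 : Tendsto (fun t => Real.exp (-D.C * t)) atTop (𝓝 0) :=
      Real.tendsto_exp_atBot.comp (tendsto_id.const_mul_atTop_of_neg (neg_lt_zero.2 hC))
    refine squeeze_zero_norm (fun t => ?_) (by simpa only [zero_mul] using h1.mul_const (B' + B'))
    rw [hF, norm_mul, Real.norm_of_nonneg (Real.exp_pos _).le]
    refine mul_le_mul_of_nonneg_left ?_ (Real.exp_pos _).le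
    exact (norm_sub_le _ _).trans (add_le_add (hB' _ (z t).2) (hB' _ D.z₀.2))
  exact tendsto_nhds_unique (hlim.congr' heq) hF0

lemma IsOptimalPair.avgCost_eq {μs : ℝ → D.PUY} {zs : ℝ → D.Z} (h : D.IsOptimalPair μs zs) :
    D.avgCost μs zs = D.avgValue := by
  have : IsLeast {v | ∃ (μ : ℝ → D.PUY) (z : ℝ → D.Z),
      D.AvgAdmissible μ z ∧ z 0 = D.z₀ ∧ v = D.avgCost μ z} (D.avgCost μs zs) :=
    ⟨⟨μs, zs, h.1, h.2.1, rfl⟩, by rintro _ ⟨μ, z, h1, h2, rfl⟩; exact h.2.2 μ z h1 h2⟩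
  exact this.csInf_eq.symm

/-- The discounted occupational measure of an optimal pair solves the averaged IDLP problem. -/
lemma IsOptimalPair.exists_isOptimalIDLP {μs : ℝ → D.PUY} {zs : ℝ → D.Z}
    (h : D.IsOptimalPair μs zs) (hval : D.C * D.avgValue = D.idlpValue) :
    ∃ p, D.IsOptimalIDLP p ∧ ∀ V : Set (D.PUY × D.Z), IsOpen V →
      (∀ᵐ x ∂(p : Measure (D.PUY × D.Z)), x ∈ Vᶜ) → ∀ᵐ t ∂halfLine, (μs t, zs t) ∉ V := by
  have hC := D.C_pos
  have hprob := isProbabilityMeasure_discountMeasure hC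
  have hm : AEMeasurable (fun t => (μs t, zs t)) (discountMeasure D.C) :=
    h.1.aemeasurable_pair.mono_ac (withDensity_absolutelyContinuous _ _)
  let p : ProbabilityMeasure (D.PUY × D.Z) :=
    ⟨(discountMeasure D.C).map fun t => (μs t, zs t), Measure.isProbabilityMeasure_map hm⟩
  have hp : ∀ q : D.PUY × D.Z → ℝ, Continuous q → ∫ x, q x ∂(p : Measure (D.PUY × D.Z)) =
      D.C * ∫ t in Ioi (0 : ℝ), Real.exp (-D.C * t) * q (μs t, zs t) := by
    intro q hq
    rw [← integral_discountMeasure hC (fun t => q (μs t, zs t))]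
    exact integral_map hm hq.measurable.aestronglyMeasurable
  have hcost : D.idlpCost p = D.C * D.avgCost μs zs := hp _ D.continuous_GTilde
  refine ⟨p, D.isOptimalIDLP_of_cost_le ⟨?_, fun ψ hψ => ?_⟩ ?_, fun V hV hae => ?_⟩
  · refine (ae_map_iff hm D.isClosed_graph_W.measurableSet).2 (ae_discountMeasure_of_ae ?_)
    filter_upwards [h.1.2.2] with t ht using ht.1
  · rw [hp _ (D.continuous_constraintFun hψ), h.1.integral_exp_mul_constraintFun h.2.1 hψ,
      mul_zero]
  -- Here the assumed equality of the two optimal values turns feasibility into optimality.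
  · rw [hcost, h.avgCost_eq, hval]
  · exact ae_of_ae_discountMeasure hC ((ae_map_iff hm hV.isClosed_compl.measurableSet).1 hae)

end SPData

/-! ### Approximating feedbacks and trajectories along the optimal pair -/

/-- Continuity from either side keeps `w` in `V` on an interval of positive length ending or
starting at `t`. The condition `0 < t` leaves room on the left. -/
lemma not_ae_halfLine_notMem_of_continuousWithinAt {X : Type*} [TopologicalSpace X] {w : ℝ → X}
    {t : ℝ} (ht : 0 < t)
    (hw : ContinuousWithinAt w (Icc 0 t) t ∨ ContinuousWithinAt w (Ici t) t) {V : Set X}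
    (hV : IsOpen V) (hmem : w t ∈ V) : ¬ ∀ᵐ s ∂halfLine, w s ∉ V := by
  suffices ∃ a b : ℝ, 0 ≤ a ∧ a < b ∧ ∀ s ∈ Ioo a b, w s ∈ V by
    obtain ⟨a, b, ha, hab, hs⟩ := this
    intro hae
    rw [ae_halfLine_iff, ae_iff] at hae
    have hsub : Ioo a b ⊆ {s | ¬(0 ≤ s → w s ∉ V)} := fun s hs' => by
      simp only [mem_ofPred_eq, Classical.not_imp, not_not]
      exact ⟨ha.trans hs'.1.le, hs s hs'⟩
    have := measure_mono_null hsub hae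
    rw [Real.volume_Ioo, ENNReal.ofReal_eq_zero] at this
    linarith
  rcases hw with hw | hw
  · have h1 : w ⁻¹' V ∈ 𝓝[<] t := by
      have : 𝓝[<] t ≤ 𝓝[Icc 0 t] t := by
        rw [← nhdsWithin_Ioo_eq_nhdsLT ht]
        exact nhdsWithin_mono _ Ioo_subset_Icc_self
      exact this (hw (hV.mem_nhds hmem))
    obtain ⟨l, hl, hsub⟩ := (mem_nhdsLT_iff_exists_Ioo_subset).1 h1
    exact ⟨max l 0, t, le_max_right _ _, max_lt hl ht,
      fun s hs => hsub ⟨(le_max_left _ _).trans_lt hs.1, hs.2⟩⟩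
  · have h1 : w ⁻¹' V ∈ 𝓝[>] t :=
      nhdsWithin_mono _ Ioi_subset_Ici_self (hw (hV.mem_nhds hmem))
    obtain ⟨r, hr, hsub⟩ := (mem_nhdsGT_iff_exists_Ioo_subset).1 h1
    exact ⟨t, r, ht.le, hr, fun s hs => hsub hs⟩

lemma ae_halfLine_pos : ∀ᵐ t ∂halfLine, 0 < t := by
  rw [ae_halfLine_iff]
  filter_upwards [measure_eq_zero_iff_ae_notMem.1 (measure_singleton (μ := volume) (0 : ℝ))]
    with t ht h0
  exact lt_of_le_of_ne h0 fun h => ht h.symm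

lemma tendsto_volume_real_inter {bad : ℕ × ℕ → Set ℝ} {T : ℝ}
    (h : DoubleLimZero fun N M => volume.real {t | t ∈ Icc 0 T ∧ t ∈ bad (N, M)}) :
    Tendsto (fun p => volume.real (Icc 0 T ∩ bad p)) iteratedAtTop (𝓝 0) :=
  h.tendsto fun _ _ => measureReal_nonneg

namespace Approximation

variable {D : SPData U m n} {A : Approximation D}
  {μs : ℝ → D.PUY} {zs : ℝ → D.Z} {us : ℝ → ℝ → U} {ys : ℝ → ℝ → D.Y}
  {yinit : ℕ → ℕ → D.Z → D.Y} {μNM : ℕ → ℕ → D.Z → D.PUY}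
  {q : ℕ → C(U × D.Y, ℝ)} {rQ : ℝ → ℝ} {zNM : ℕ → ℕ → ℝ → D.Z} {rB : ℝ → ℝ → ℝ}

/-- Near each point of the optimal averaged trajectory there is, for large `N` and `M`, a measure
satisfying the complementary slackness condition of the approximating problem. -/
lemma AssumptionOne.exists_minimizer (h1 : A.AssumptionOne μs zs us ys yinit μNM) {t : ℝ}
    (ht : 0 < t) {V : Set (D.PUY × D.Z)} (hV : IsOpen V) (hmem : (μs t, zs t) ∈ V) :
    ∃ k, ∀ N ≥ k, ∀ M ≥ k, ∀ ζ, D.IsAvgDualSolution A.ψ A.φ N M ζ →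
      ∃ x ∈ V, x.1 ∈ D.WM A.φ M x.2 ∧ ∀ μ ∈ D.WM A.φ M x.2,
        D.GTilde x.1 x.2 + fderiv ℝ ζ x.2 (D.gTilde x.1 x.2) ≤
          D.GTilde μ x.2 + fderiv ℝ ζ x.2 (D.gTilde μ x.2) := by
  obtain ⟨p₀, _, hu₀⟩ := h1.unique_optimal
  obtain ⟨p, hp, hpV⟩ := h1.optimal_pair.exists_isOptimalIDLP h1.values_eq
  refine D.exists_forall_exists_minimizer A.ψ_total A.φ_total hp
    (fun p' hp' => (hu₀ p' hp').trans (hu₀ p hp).symm) hV fun hae => ?_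
  refine not_ae_halfLine_notMem_of_continuousWithinAt ht ?_ hV hmem (hpV V hV hae)
  have hz := D.continuousOn_of_absolutelyContinuous h1.optimal_pair.1.2.1 t ht.le
  exact (h1.regular.2 t ht.le).imp
    (fun h => h.prodMk (hz.mono Icc_subset_Ici_self))
    (fun h => h.prodMk (hz.mono (Ici_subset_Ici.2 ht.le)))

lemma isOpen_setOf_dist_add_lt (u₀ : U) (y₀ : D.Y) (r : ℝ) :
    IsOpen {w : U × D.Y | dist w.1 u₀ + dist w.2 y₀ < r} :=
  isOpen_lt (by fun_prop) continuous_const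

/-- The approximating feedback controls, evaluated along the optimal trajectories, converge to the
optimal controls. -/
lemma eventually_dist_control_le (h1 : A.AssumptionOne μs zs us ys yinit μNM) {t τ L : ℝ}
    (ht : 0 < t)
    (hpos : ∀ r > 0, 0 < (μs t : Measure (U × D.Y))
      {w | dist w.1 (us t τ) + dist w.2 (ys t τ) < r})
    (hQ : 0 < rQ t) (hB : 0 < rB t τ)
    (huniq : ∀ N ≥ 1, ∀ M ≥ 1,
      ∀ y ∈ Metric.ball (ys t τ) (rB t τ), ∀ z ∈ Metric.ball (zs t) (rQ t), ∀ v : U,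
        (∀ v', D.ham (A.ζ N M) (A.η N M z) v y z ≤ D.ham (A.ζ N M) (A.η N M z) v' y z) →
          v = A.u N M y z)
    (hlip : ∀ N ≥ 1, ∀ M ≥ 1,
      ∀ y' ∈ Metric.ball (ys t τ) (rB t τ), ∀ z' ∈ Metric.ball (zs t) (rQ t),
      ∀ y'' ∈ Metric.ball (ys t τ) (rB t τ), ∀ z'' ∈ Metric.ball (zs t) (rQ t),
        dist (A.u N M y' z') (A.u N M y'' z'') ≤ L * (dist y' y'' + dist z' z''))
    {ε : ℝ} (hε : 0 < ε) :
    ∀ᶠ p in iteratedAtTop, dist (A.u p.1 p.2 (ys t τ) (zs t)) (us t τ) ≤ ε := by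
  set L' := |L| + 1 with hL'
  have hL0 : 0 < L' := by positivity
  obtain ⟨δ, hδ0, hδB, hδQ, hδε⟩ : ∃ δ : ℝ, 0 < δ ∧ δ ≤ rB t τ ∧ δ ≤ rQ t ∧
      L' * (δ + δ) + δ ≤ ε := by
    -- The last condition on `δ` reads `(2 L' + 1) δ ≤ ε`: the Lipschitz step costs `2 L' δ`, the
    -- distance of the controls costs `δ`.
    refine ⟨min (min (rB t τ) (rQ t)) (ε / (2 * L' + 1)), by positivity,
      (min_le_left _ _).trans (min_le_left _ _), (min_le_left _ _).trans (min_le_right _ _), ?_⟩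
    have := min_le_right (min (rB t τ) (rQ t)) (ε / (2 * L' + 1))
    set δ := min (min (rB t τ) (rQ t)) (ε / (2 * L' + 1))
    rw [le_div_iff₀ (by positivity)] at this
    linarith
  set O : Set (U × D.Y) := {w | dist w.1 (us t τ) + dist w.2 (ys t τ) < δ} with hO
  have hOo : IsOpen O := isOpen_setOf_dist_add_lt _ _ _
  -- Pairs whose measure charges a small neighbourhood of `(us t τ, ys t τ)` and whose state is
  -- close to `zs t`. It contains `(μs t, zs t)` by the support assumption.
  let V : Set (D.PUY × D.Z) :=
    {μ : D.PUY | ∀ᵐ w ∂(μ : Measure (U × D.Y)), w ∈ Oᶜ}ᶜ ×ˢ Metric.ball (zs t) δ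
  have hV : IsOpen V :=
    (isClosed_setOf_ae_mem hOo.isClosed_compl).isOpen_compl.prod Metric.isOpen_ball
  have hmem : (μs t, zs t) ∈ V := by
    refine ⟨fun hae => ?_, Metric.mem_ball_self hδ0⟩
    have h0 : (μs t : Measure (U × D.Y)) O = 0 := measure_eq_zero_iff_ae_notMem.2 hae
    exact (hpos δ hδ0).ne' h0
  obtain ⟨k, hk⟩ := h1.exists_minimizer ht hV hmem
  refine eventually_iteratedAtTop_of_ge (max k 1) fun N hN M hM => ?_
  have hN1 : 1 ≤ N := (le_max_right _ _).trans hN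
  have hM1 : 1 ≤ M := (le_max_right _ _).trans hM
  obtain ⟨⟨μ, z⟩, ⟨hμV, hzV⟩, hμW, hμmin⟩ := hk N ((le_max_left _ _).trans hN) M
    ((le_max_left _ _).trans hM) _ (A.ζ_sol N hN1 M hM1)
  have hae := D.ae_ham_le A.φ_total.1 hμW hμmin (A.η_sol N hN1 M hM1 z)
  have hfreq : ∃ᵐ w ∂(μ : Measure (U × D.Y)), w ∈ O := fun h => hμV h
  obtain ⟨⟨u, y⟩, hw, hmin⟩ := (hfreq.and_eventually hae).exists
  have hw' : dist u (us t τ) + dist y (ys t τ) < δ := hw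
  have hdu : dist u (us t τ) < δ := by linarith [dist_nonneg (x := y) (y := ys t τ)]
  have hdy : dist y (ys t τ) < δ := by linarith [dist_nonneg (x := u) (y := us t τ)]
  have hdz : dist z (zs t) < δ := hzV
  have hyB : y ∈ Metric.ball (ys t τ) (rB t τ) := hdy.trans_le hδB
  have hzQ : z ∈ Metric.ball (zs t) (rQ t) := hdz.trans_le hδQ
  -- A minimizing control found near the optimal one must be the value of the feedback at the nearby
  -- point `(y, z)`.
  have hu : u = A.u N M y z := huniq N hN1 M hM1 y hyB z hzQ u hmin
  have hl := hlip N hN1 M hM1 (ys t τ) (Metric.mem_ball_self hB) (zs t)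
    (Metric.mem_ball_self hQ) y hyB z hzQ
  rw [← hu] at hl
  have hl2 : L * (dist (ys t τ) y + dist (zs t) z) ≤ L' * (δ + δ) := by
    rw [dist_comm _ y, dist_comm _ z]
    calc _ ≤ L' * (dist y (ys t τ) + dist z (zs t)) := by
          gcongr
          linarith [le_abs_self L]
      _ ≤ _ := by gcongr
  calc dist (A.u N M (ys t τ) (zs t)) (us t τ)
      ≤ dist (A.u N M (ys t τ) (zs t)) u + dist u (us t τ) := dist_triangle _ _ _
    _ ≤ L' * (δ + δ) + δ := by linarith
    _ ≤ ε := hδε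

/-- Along the optimal averaged trajectory the approximating occupational measures converge to the
optimal ones. -/
lemma ae_tendsto_occupation (h1 : A.AssumptionOne μs zs us ys yinit μNM)
    (h2 : AssumptionTwo q zs μNM rQ zNM) (h3 : A.AssumptionThree zs ys rQ rB) :
    ∀ᵐ t ∂halfLine, Tendsto (fun p : ℕ × ℕ => μNM p.1 p.2 (zs t)) iteratedAtTop
      (𝓝 (μs t)) := by
  obtain ⟨b, hb0, _, hbest⟩ := h1.estimate
  obtain ⟨Bf, hBf⟩ := D.exists_bound_f
  obtain ⟨Lf, hLf⟩ := D.f_lip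
  filter_upwards [ae_halfLine_pos, h1.assoc_pair, hbest, h2.radius_pos, h3] with t ht0
    ⟨hadm, hgen, hsupp⟩ hest hQ h3t
  obtain ⟨h3a, ⟨L, h3b⟩, h3c⟩ := h3t ⟨zs t, Metric.mem_ball_self hQ⟩
  set z := zs t
  -- The closed-loop solution is started on the optimal curve, where it can be compared with `ys t`.
  -- It still generates `μNM N M (zs t)`, as the occupational measure does not depend on the initial
  -- value near that curve.
  set x : ℕ × ℕ → ℝ → D.Y := fun p => A.y p.1 p.2 z (ys t 0) with hx
  set c : ℕ × ℕ → ℝ → U := fun p => A.ctrl p.1 p.2 z (ys t 0) with hc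
  set bad : ℕ × ℕ → Set ℝ := fun p => {τ | x p τ ∉ Metric.ball (ys t τ) (rB t τ)} with hbadef
  have hsol : ∀ p : ℕ × ℕ, 1 ≤ p.1 → 1 ≤ p.2 →
      D.IsClosedLoopSolution (fun y' => A.u p.1 p.2 y' z) z (ys t 0) (x p) :=
    fun p hp1 hp2 => (A.y_sol p.1 hp1 p.2 hp2 z (ys t 0)).1
  have hbad : ∀ T > 0, Tendsto (fun p => volume.real (Icc 0 T ∩ bad p)) iteratedAtTop (𝓝 0) :=
    fun T hT => tendsto_volume_real_inter (bad := bad) (h3c T hT)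
  have hctrl : ∀ᵐ τ ∂halfLine, ∀ ε > 0, ∀ᶠ p in iteratedAtTop, τ ∉ bad p →
      dist (c p τ) (us t τ) ≤ |L| * dist (x p τ) (ys t τ) + ε := by
    filter_upwards [hsupp, h3a, h3b] with τ hpos ⟨hB, huniq⟩ hlip ε hε
    filter_upwards [eventually_dist_control_le h1 ht0 hpos hQ hB huniq hlip hε,
      eventually_one_le_iteratedAtTop] with p hp hp1 hgood
    have hxB : x p τ ∈ Metric.ball (ys t τ) (rB t τ) := not_not.1 hgood
    have hl := hlip p.1 hp1.1 p.2 hp1.2 (x p τ) hxB z (Metric.mem_ball_self hQ) (ys t τ)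
      (Metric.mem_ball_self hB) z (Metric.mem_ball_self hQ)
    rw [dist_self, add_zero] at hl
    have hl' : dist (c p τ) (A.u p.1 p.2 (ys t τ) z) ≤ |L| * dist (x p τ) (ys t τ) :=
      hl.trans (mul_le_mul_of_nonneg_right (le_abs_self L) dist_nonneg)
    exact (dist_triangle _ _ _).trans (add_le_add hl' hp)
  have hclose : ∀ T > 0, ∀ ε > 0, ∀ᶠ p in iteratedAtTop, ∀ τ ∈ Icc 0 T,
      dist (x p τ) (ys t τ) ≤ ε := by
    intro T hT ε hε
    have := eventually_norm_sub_le_of_deriv_close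
      (x := fun p τ => (x p τ : E m)) (h := fun p τ => D.f (c p τ) (x p τ) z)
      (x₀ := fun τ => (ys t τ : E m)) (h₀ := fun τ => D.f (us t τ) (ys t τ) z)
      -- A state error enters `f` directly (the `1`) and through the feedback (the `|L|`).
      (K := |Lf| * (|L| + 1)) (B := Bf) (bad := bad) (by positivity)
      (fun p hp1 hp2 => ⟨(hsol p hp1 hp2).2.2.1, (hsol p hp1 hp2).2.2.2, by
        rw [(hsol p hp1 hp2).1]⟩)
      (fun p τ => hBf _ _ _) hadm.2.1 hadm.2.2 (fun τ => hBf _ _ _) hbad ?_ hT hε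
    · filter_upwards [this] with p hp τ hτ
      rw [Subtype.dist_eq, dist_eq_norm]
      exact hp τ hτ
    · filter_upwards [hctrl] with τ hτ δ hδ
      filter_upwards [hτ (δ / (|Lf| + 1)) (by positivity)] with p hp hgood
      have e1 := hLf (c p τ) (us t τ) (x p τ) (x p τ).2 (ys t τ) (ys t τ).2 z z.2 z z.2
      have e2 := hp hgood
      have e3 : dist (x p τ) (ys t τ) = ‖(x p τ : E m) - ys t τ‖ := by
        rw [Subtype.dist_eq, dist_eq_norm]
      rw [e3] at e2
      have e4 : |Lf| * (δ / (|Lf| + 1)) ≤ δ := by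
        rw [mul_div_assoc', div_le_iff₀ (by positivity)]
        nlinarith [abs_nonneg Lf]
      rw [sub_self, norm_zero, add_zero] at e1
      calc _ ≤ Lf * (dist (c p τ) (us t τ) + ‖(x p τ : E m) - ys t τ‖) := e1
        _ ≤ |Lf| * (dist (c p τ) (us t τ) + ‖(x p τ : E m) - ys t τ‖) :=
          mul_le_mul_of_nonneg_right (le_abs_self _) (by positivity)
        _ ≤ |Lf| * ((|L| * ‖(x p τ : E m) - ys t τ‖ + δ / (|Lf| + 1)) +
            ‖(x p τ : E m) - ys t τ‖) := by gcongr
        _ = |Lf| * (|L| + 1) * ‖(x p τ : E m) - ys t τ‖ + |Lf| * (δ / (|Lf| + 1)) := by ring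
        _ ≤ _ := by gcongr
  refine tendsto_probabilityMeasure_iff.2 fun f => ?_
  have hfb : ∀ w w', |f w - f w'| ≤ ‖f‖ + ‖f‖ := fun w w' =>
    (norm_sub_le (f w) (f w')).trans
      (add_le_add (f.norm_coe_le_norm w) (f.norm_coe_le_norm w'))
  have hmx : ∀ p : ℕ × ℕ, 1 ≤ p.1 → 1 ≤ p.2 →
      AEMeasurable (fun τ => f (c p τ, x p τ)) halfLine := fun p hp1 hp2 => by
    refine f.continuous.measurable.comp_aemeasurable ((hsol p hp1 hp2).2.1.prodMk ?_)
    exact ((IsInducing.subtypeVal.continuousOn_iff.2 (continuousOn_Ici_of_absolutelyContinuous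
      (hsol p hp1 hp2).2.2.1)).aemeasurable measurableSet_Ici)
  have hms : AEMeasurable (fun τ => f (us t τ, ys t τ)) halfLine :=
    f.continuous.measurable.comp_aemeasurable hgen.1
  have hint : ∀ S > 0, Tendsto (fun p => ∫ τ in Icc 0 S,
      |f (c p τ, x p τ) - f (us t τ, ys t τ)|) iteratedAtTop (𝓝 0) := by
    intro S hS
    have hle : volume.restrict (Icc 0 S) ≤ halfLine :=
      Measure.restrict_mono (fun s hs => hs.1) le_rfl
    refine tendsto_integral_iterated (bad := bad) (B := ‖f‖ + ‖f‖)
      (F := fun p τ => f (c p τ, x p τ) - f (us t τ, ys t τ))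
      (fun p hp1 hp2 => ((hmx p hp1 hp2).sub hms).mono_measure hle)
      (fun p τ => hfb _ _) ?_ ?_
    · refine (hbad S hS).congr fun p => ?_
      rw [measureReal_restrict_apply' measurableSet_Icc, inter_comm]
    · filter_upwards [ae_mono hle hctrl, ae_restrict_mem measurableSet_Icc] with τ hτ hmem ε hε
      obtain ⟨δ, hδ0, hδ⟩ := Metric.continuousAt_iff.1
        (f.continuous.continuousAt (x := (us t τ, ys t τ))) ε hε
      filter_upwards [hτ (δ / 4) (by positivity),
        hclose S hS (δ / (4 * (|L| + 1))) (by positivity)] with p hp1 hp2 hgood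
      have e1 := hp1 hgood
      have e2 := hp2 τ hmem
      rw [le_div_iff₀ (by positivity)] at e2
      have e3 : 0 ≤ |L| * dist (x p τ) (ys t τ) := by positivity
      have e4 : 0 ≤ dist (x p τ) (ys t τ) := dist_nonneg
      refine (hδ (?_ : dist (c p τ, x p τ) (us t τ, ys t τ) < δ)).le
      rw [Prod.dist_eq]
      exact max_lt (by linarith) (by linarith)
  rw [Metric.tendsto_nhds]
  intro ε hε
  have hS1 := (tendsto_order.1 (hb0 f)).2 (ε / 4) (by positivity)
  have hS2 := Metric.tendsto_nhds.1 (hgen.2 f) (ε / 4) (by positivity)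
  -- One time horizon `S` serves all `N` and `M`, since the rate `b` does not depend on them. This
  -- permits exchanging the limit in `S` with the iterated limit.
  obtain ⟨S, ⟨hbS, hgS⟩, hS0⟩ := ((hS1.and hS2).and (eventually_gt_atTop 0)).exists
  filter_upwards [(tendsto_order.1 (hint S hS0)).2 (S * (ε / 4)) (by positivity),
    eventually_one_le_iteratedAtTop] with p hp hp1
  obtain ⟨O, _, hO, hOest⟩ := hest p.1 hp1.1 p.2 hp1.2
  have e1 := (hOest (ys t 0) (hO 0 le_rfl)).2 f S hS0
  have e2 : |S⁻¹ * (∫ τ in (0 : ℝ)..S, f (c p τ, x p τ)) -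
      S⁻¹ * ∫ τ in (0 : ℝ)..S, f (us t τ, ys t τ)| ≤ ε / 4 := by
    have i1 : IntervalIntegrable (fun τ => f (c p τ, x p τ)) volume 0 S :=
      intervalIntegrable_of_bound le_rfl hS0.le (hmx p hp1.1 hp1.2).aestronglyMeasurable
        fun τ => f.norm_coe_le_norm _
    have i2 : IntervalIntegrable (fun τ => f (us t τ, ys t τ)) volume 0 S :=
      intervalIntegrable_of_bound le_rfl hS0.le hms.aestronglyMeasurable
        fun τ => f.norm_coe_le_norm _
    rw [← mul_sub, ← intervalIntegral.integral_sub i1 i2, abs_mul, abs_of_pos (inv_pos.2 hS0),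
      inv_mul_le_iff₀ hS0]
    refine le_trans ?_ hp.le
    rw [integral_Icc_eq_integral_Ioc, ← intervalIntegral.integral_of_le hS0.le]
    exact intervalIntegral.abs_integral_le_integral_abs hS0.le
  rw [Real.dist_eq] at hgS ⊢
  change |S⁻¹ * (∫ τ in (0 : ℝ)..S, f (c p τ, x p τ)) - _| ≤ _ at e1
  rw [abs_lt] at hgS ⊢
  rw [abs_le] at e1 e2
  constructor <;> linarith [e1.1, e1.2, e2.1, e2.2, hgS.1, hgS.2]

/-- The trajectories generated by the approximating families converge to the optimal one. -/
lemma eventually_dist_trajectory_le (h1 : A.AssumptionOne μs zs us ys yinit μNM)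
    (h2 : AssumptionTwo q zs μNM rQ zNM) (h3 : A.AssumptionThree zs ys rQ rB)
    {T : ℝ} (hT : 0 < T) {ε : ℝ} (hε : 0 < ε) :
    ∀ᶠ p in iteratedAtTop, ∀ t ∈ Icc 0 T, dist (zNM p.1 p.2 t) (zs t) ≤ ε := by
  obtain ⟨B, hB⟩ := D.exists_bound_gTilde
  obtain ⟨L, hL⟩ := h2.lipschitz
  set bad : ℕ × ℕ → Set ℝ := fun p => {t | zNM p.1 p.2 t ∉ Metric.ball (zs t) (rQ t)} with hbad
  have hopt := h1.optimal_pair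
  have := eventually_norm_sub_le_of_deriv_close
    (x := fun p t => (zNM p.1 p.2 t : E n))
    (h := fun p t => D.gTilde (μNM p.1 p.2 (zNM p.1 p.2 t)) (zNM p.1 p.2 t))
    (x₀ := fun t => (zs t : E n)) (h₀ := fun t => D.gTilde (μs t) (zs t))
    (K := |L|) (B := B) (bad := bad) (by positivity)
    (fun p hp1 hp2 => by
      obtain ⟨e1, e2, e3⟩ := (h2.solution p.1 hp1 p.2 hp2).1
      exact ⟨e2, e3, by rw [e1, hopt.2.1]⟩)
    (fun p t => hB _ _) hopt.1.2.1 (by filter_upwards [hopt.1.2.2] with t ht using ht.2)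
    (fun t => hB _ _)
    (fun T hT => tendsto_volume_real_inter (bad := bad) (h2.small_exit T hT)) ?_ hT hε
  · filter_upwards [this] with p hp t ht
    rw [Subtype.dist_eq, dist_eq_norm]
    exact hp t ht
  · filter_upwards [hL, h2.radius_pos, ae_tendsto_occupation h1 h2 h3] with t hLt hQ hμ δ hδ
    have hg : Tendsto (fun p : ℕ × ℕ => D.gTilde (μNM p.1 p.2 (zs t)) (zs t)) iteratedAtTop
        (𝓝 (D.gTilde (μs t) (zs t))) :=
      (D.continuous_gTilde.tendsto (μs t, zs t)).comp (hμ.prodMk_nhds tendsto_const_nhds)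
    filter_upwards [Metric.tendsto_nhds.1 hg δ hδ, eventually_one_le_iteratedAtTop]
      with p hp hp1 hgood
    -- Convergence of the measures is known only at `zs t`. The uniform Lipschitz bound on `Q_t`
    -- transfers it to the velocity at `zNM p.1 p.2 t`, at the cost of a multiple of the distance
    -- that Grönwall absorbs.
    have e1 := hLt p.1 hp1.1 p.2 hp1.2 (zNM p.1 p.2 t) (not_not.1 hgood) (zs t)
      (Metric.mem_ball_self hQ)
    rw [dist_eq_norm] at hp
    have e2 : L * dist (zNM p.1 p.2 t) (zs t) ≤ |L| * ‖(zNM p.1 p.2 t : E n) - zs t‖ := by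
      rw [Subtype.dist_eq, dist_eq_norm]
      exact mul_le_mul_of_nonneg_right (le_abs_self _) (norm_nonneg _)
    exact (norm_sub_le_norm_sub_add_norm_sub _ (D.gTilde (μNM p.1 p.2 (zs t)) (zs t)) _).trans
      (add_le_add (e1.trans e2) hp.le)

/-- The measures converge at `zs t`, and the modulus `κ`, common to all `N` and `M`, controls the
passage from `zs t` to the nearby state of the approximating trajectory. -/
lemma ae_tendsto_rho (hq : IsDenseLipschitzSeq q)
    (h1 : A.AssumptionOne μs zs us ys yinit μNM)
    (h2 : AssumptionTwo q zs μNM rQ zNM) (h3 : A.AssumptionThree zs ys rQ rB) :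
    ∀ᵐ t ∂halfLine, Tendsto (fun p : ℕ × ℕ => rho q (μNM p.1 p.2 (zNM p.1 p.2 t)) (μs t))
      iteratedAtTop (𝓝 0) := by
  filter_upwards [ae_halfLine_pos, h2.continuity, h2.radius_pos, ae_tendsto_occupation h1 h2 h3]
    with t ht ⟨κ, hκ, hκle⟩ hQ hμ
  have hρ := tendsto_rho_of_tendsto hq hμ
  refine tendsto_order.2 ⟨fun b hb => Eventually.of_forall fun p => hb.trans_le (rho_nonneg _ _ _),
    fun ε hε => ?_⟩
  have hκ' := (tendsto_order.1 hκ).2 (ε / 2) (by positivity)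
  obtain ⟨δ, hδ0, hδ⟩ := (mem_nhdsGT_iff_exists_Ioo_subset).1 hκ'
  have hδ0' : (0 : ℝ) < δ := hδ0
  filter_upwards [(tendsto_order.1 hρ).2 (ε / 2) (by positivity),
    eventually_one_le_iteratedAtTop,
    eventually_dist_trajectory_le h1 h2 h3 ht (ε := min δ (rQ t) / 2) (by positivity)]
    with p hp hp1 hpz
  have hd : dist (zNM p.1 p.2 t) (zs t) < min δ (rQ t) :=
    (hpz t ⟨ht.le, le_rfl⟩).trans_lt (half_lt_self (by positivity))
  have hle : rho q (μNM p.1 p.2 (zNM p.1 p.2 t)) (μNM p.1 p.2 (zs t)) ≤ ε / 2 := by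
    -- The value `κ 0` is unrestricted, so coinciding states are treated apart.
    by_cases heq : zNM p.1 p.2 t = zs t
    · rw [heq, rho_self]; positivity
    · refine (hκle p.1 hp1.1 p.2 hp1.2 _ (hd.trans_le (min_le_right _ _)) _
        (Metric.mem_ball_self hQ) heq).trans ?_
      exact le_of_lt (hδ ⟨dist_pos.2 heq, hd.trans_le (min_le_left _ _)⟩)
  have := rho_triangle hq (μNM p.1 p.2 (zNM p.1 p.2 t)) (μNM p.1 p.2 (zs t)) (μs t)
  linarith

lemma aemeasurable_GTilde_feedback {μ : D.Z → D.PUY}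
    (hμ : ∀ f : C(U × D.Y, ℝ), Measurable fun z => ∫ w, f w ∂(μ z : Measure (U × D.Y)))
    {z : ℝ → D.Z} (hz : D.IsAvgFeedbackSolution μ z) :
    AEMeasurable (fun t => D.GTilde (μ (z t)) (z t)) halfLine := by
  have h : Measurable fun z' : D.Z => D.GTilde (μ z') z' :=
    measurable_integral_param (X := U × D.Y) hμ D.continuous_G
  exact h.comp_aemeasurable
    ((D.continuousOn_of_absolutelyContinuous hz.2.1).aemeasurable measurableSet_Ici)

/-- Up to the factor `1 / C` the cost is an integral against the discount probability measure. The
integrands are bounded and converge for almost every `t`, so dominated convergence applies with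
empty exceptional sets. -/
lemma tendsto_abs_avgCost_sub (hq : IsDenseLipschitzSeq q)
    (h1 : A.AssumptionOne μs zs us ys yinit μNM)
    (h2 : AssumptionTwo q zs μNM rQ zNM) (h3 : A.AssumptionThree zs ys rQ rB) :
    Tendsto (fun p : ℕ × ℕ => |D.avgCost (fun t => μNM p.1 p.2 (zNM p.1 p.2 t)) (zNM p.1 p.2) -
      D.avgValue|) iteratedAtTop (𝓝 0) := by
  have hC := D.C_pos
  have hprob := isProbabilityMeasure_discountMeasure hC
  have hac : discountMeasure D.C ≪ halfLine := withDensity_absolutelyContinuous _ _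
  obtain ⟨B, hB⟩ := D.exists_bound_GTilde
  have hms : AEMeasurable (fun t => D.GTilde (μs t) (zs t)) halfLine :=
    D.continuous_GTilde.measurable.comp_aemeasurable h1.optimal_pair.1.aemeasurable_pair
  have hm : ∀ p : ℕ × ℕ, 1 ≤ p.1 → 1 ≤ p.2 → AEMeasurable
      (fun t => D.GTilde (μNM p.1 p.2 (zNM p.1 p.2 t)) (zNM p.1 p.2 t)) halfLine :=
    fun p hp1 hp2 => aemeasurable_GTilde_feedback (h1.measurable p.1 hp1 p.2 hp2)
      (h2.solution p.1 hp1 p.2 hp2).1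
  have hlim := tendsto_integral_iterated (ν := discountMeasure D.C) (bad := fun _ => ∅)
    (B := B + B) (F := fun p t => D.GTilde (μNM p.1 p.2 (zNM p.1 p.2 t)) (zNM p.1 p.2 t) -
      D.GTilde (μs t) (zs t))
    (fun p hp1 hp2 => ((hm p hp1 hp2).sub hms).mono_ac hac)
    (fun p t => (abs_sub _ _).trans (add_le_add (hB _ _) (hB _ _)))
    (by simp only [measureReal_empty]; exact tendsto_const_nhds) (ae_discountMeasure_of_ae ?_)
  · refine squeeze_zero' (Eventually.of_forall fun _ => abs_nonneg _) ?_
      (by simpa using hlim.const_mul D.C⁻¹)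
    filter_upwards [eventually_one_le_iteratedAtTop] with p hp1
    have hI : ∀ {G : ℝ → ℝ}, AEMeasurable G halfLine → (∀ t, |G t| ≤ B) →
        Integrable G (discountMeasure D.C) := fun hG hGB =>
      Integrable.of_bound (hG.mono_ac hac).aestronglyMeasurable B (Eventually.of_forall hGB)
    have e1 : ∀ (μ : ℝ → D.PUY) (z : ℝ → D.Z), D.avgCost μ z =
        D.C⁻¹ * ∫ t, D.GTilde (μ t) (z t) ∂(discountMeasure D.C) := by
      intro μ z
      rw [integral_discountMeasure hC, inv_mul_cancel_left₀ hC.ne']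
      rfl
    rw [← h1.optimal_pair.avgCost_eq, e1, e1, ← mul_sub, abs_mul, abs_of_pos (inv_pos.2 hC),
      ← integral_sub (hI (hm p hp1.1 hp1.2) fun t => hB _ _) (hI hms fun t => hB _ _)]
    gcongr
    exact abs_integral_le_integral_abs
  · filter_upwards [ae_halfLine_pos, ae_tendsto_rho hq h1 h2 h3] with t ht hρ ε hε
    have hμ := tendsto_of_tendsto_rho hq hρ
    have hz : Tendsto (fun p : ℕ × ℕ => zNM p.1 p.2 t) iteratedAtTop (𝓝 (zs t)) := by
      rw [Metric.tendsto_nhds]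
      intro δ hδ
      filter_upwards [eventually_dist_trajectory_le h1 h2 h3 ht (half_pos hδ)] with p hp
      exact (hp t ⟨ht.le, le_rfl⟩).trans_lt (half_lt_self hδ)
    have hG := (D.continuous_GTilde.tendsto (μs t, zs t)).comp (hμ.prodMk_nhds hz)
    filter_upwards [Metric.tendsto_nhds.1 hG ε hε] with p hp _
    exact le_of_lt hp

/-! ### Time averages uniform in `z` -/

/-- The constructed families are average control generating. -/
lemma AssumptionOne.isACGFamily (h1 : A.AssumptionOne μs zs us ys yinit μNM) {N M : ℕ}
    (hN : 1 ≤ N) (hM : 1 ≤ M) {zsol : ℝ → D.Z}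
    (hz : D.IsUniqueAvgFeedbackSolution (μNM N M) zsol) :
    D.IsACGFamily (fun z => A.ctrl N M z (yinit N M z)) (fun z => A.y N M z (yinit N M z))
      (μNM N M) zsol where
  admissible z := (A.y_sol N hN M hM z (yinit N M z)).1.2
  generates z := h1.generates N hN M hM z
  measurable f := measurable_integral_param (X := U × D.Y) (h1.measurable N hN M hM)
    (q := fun w z => f (w.1, w.2, z)) (by fun_prop)
  unique_solution := hz
  estimate f := by
    obtain ⟨b, hb0, hb, _⟩ := h1.estimate
    -- A test function on `U × Y × Z` is a continuous family in `C(U × Y)` over the compact `Z`.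
    -- Finitely many members approximate all of it, so the rates `b` of these give a rate uniform in
    -- `z`.
    let F : C(D.Z, C(U × D.Y, ℝ)) := ContinuousMap.curry
      ⟨fun x : D.Z × (U × D.Y) => f (x.2.1, x.2.2, x.1), by fun_prop⟩
    let w : D.Z → ℝ → U × D.Y := fun z τ =>
      (A.ctrl N M z (yinit N M z) τ, A.y N M z (yinit N M z) τ)
    let e : ℝ → D.Z → ℝ := fun S z => |S⁻¹ * (∫ τ in (0 : ℝ)..S, F z (w z τ)) -
      ∫ x, F z x ∂(μNM N M z : Measure (U × D.Y))|
    have hw : ∀ (z : D.Z) (g : C(U × D.Y, ℝ)),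
        AEStronglyMeasurable (fun τ => g (w z τ)) halfLine := fun z g =>
      (g.continuous.measurable.comp_aemeasurable
        (h1.generates N hN M hM z).1).aestronglyMeasurable
    -- Replacing the test function costs its sup distance twice, in the time average and in the
    -- mean.
    have hcmp : ∀ S > 0, ∀ z z', e S z ≤ b (F z') S + 2 * ‖F z - F z'‖ := by
      intro S hS z z'
      have e1 := hb N hN M hM z (F z') S hS
      have e2 := abs_integral_sub_le_norm (F z) (F z') (μNM N M z)
      have e3 : |S⁻¹ * (∫ τ in (0 : ℝ)..S, F z (w z τ)) -
          S⁻¹ * ∫ τ in (0 : ℝ)..S, F z' (w z τ)| ≤ ‖F z - F z'‖ := by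
        rw [← mul_sub, ← intervalIntegral.integral_sub
          (intervalIntegrable_of_bound le_rfl hS.le (hw z _) fun τ => (F z).norm_coe_le_norm _)
          (intervalIntegrable_of_bound le_rfl hS.le (hw z _) fun τ => (F z').norm_coe_le_norm _),
          abs_mul, abs_of_pos (inv_pos.2 hS), inv_mul_le_iff₀ hS, mul_comm]
        have := intervalIntegral.norm_integral_le_of_norm_le_const (a := 0) (b := S)
          (f := fun τ => F z (w z τ) - F z' (w z τ)) (C := ‖F z - F z'‖)
          fun τ _ => (F z - F z').norm_coe_le_norm (w z τ)
        rwa [sub_zero, abs_of_pos hS] at this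
      change |S⁻¹ * (∫ τ in (0 : ℝ)..S, F z' (w z τ)) - _| ≤ _ at e1
      simp only [e]
      rw [abs_le] at e1 e2 e3 ⊢
      constructor <;> linarith [e1.1, e1.2, e2.1, e2.2, e3.1, e3.2]
    have hbdd : ∀ S > 0, BddAbove (range (e S)) := by
      intro S hS
      obtain ⟨R, hR⟩ := isCompact_univ.exists_bound_of_continuousOn
        (F.continuous.sub (continuous_const (y := F D.z₀))).continuousOn
      refine ⟨b (F D.z₀) S + 2 * R, ?_⟩
      rintro _ ⟨z, rfl⟩
      have : ‖F z - F D.z₀‖ ≤ R := hR z (mem_univ z)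
      linarith [hcmp S hS z D.z₀]
    have hunif : ∀ ε > 0, ∀ᶠ S in atTop, ∀ z, e S z ≤ ε := by
      intro ε hε
      have hcov := isCompact_univ.elim_nhds_subcover
        (fun z' : D.Z => {z | ‖F z - F z'‖ < ε / 4}) fun z' _ =>
          (isOpen_lt (by fun_prop) continuous_const).mem_nhds
            (show ‖F z' - F z'‖ < ε / 4 by rw [sub_self, norm_zero]; positivity)
      obtain ⟨s, _, hs⟩ := hcov
      have hall : ∀ᶠ S in atTop, ∀ z' ∈ s, b (F z') S < ε / 2 :=
        (Filter.eventually_all_finset s).2 fun z' _ =>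
          (tendsto_order.1 (hb0 (F z'))).2 _ (by positivity)
      filter_upwards [hall, eventually_gt_atTop 0] with S hS hS0 z
      obtain ⟨z', hz', hzz'⟩ := mem_iUnion₂.1 (hs (mem_univ z))
      have h4 : ‖F z - F z'‖ < ε / 4 := hzz'
      linarith [hcmp S hS0 z z', hS z' hz']
    -- The rate is the worst error over `z`; `hbdd` makes this supremum an upper bound.
    refine ⟨fun S => ⨆ z, e S z, ?_, fun S hS z => le_ciSup (hbdd S hS) z⟩
    refine tendsto_order.2 ⟨fun c hc => ?_, fun c hc => ?_⟩
    · filter_upwards [eventually_gt_atTop 0] with S hS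
      exact hc.trans_le ((abs_nonneg _).trans (le_ciSup (hbdd S hS) D.z₀))
    · have : Nonempty D.Z := ⟨D.z₀⟩
      filter_upwards [hunif (c / 2) (by positivity)] with S hS
      exact (ciSup_le hS).trans_lt (half_lt_self hc)

end Approximation

end SPControl

end

/-! ### Assembly of the theorem -/

theorem mainTheorem1 {U : Type*} [MetricSpace U] [CompactSpace U] [MeasurableSpace U]
    [BorelSpace U] {m n : ℕ} (D : SPControl.SPData U m n) (A : SPControl.Approximation D)
    (q : ℕ → C(U × D.Y, ℝ)) (hq : SPControl.IsDenseLipschitzSeq q)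
    (μs : ℝ → D.PUY) (zs : ℝ → D.Z) (us : ℝ → ℝ → U) (ys : ℝ → ℝ → D.Y)
    (yinit : ℕ → ℕ → D.Z → D.Y) (μNM : ℕ → ℕ → D.Z → D.PUY)
    (rQ : ℝ → ℝ) (zNM : ℕ → ℕ → ℝ → D.Z) (rB : ℝ → ℝ → ℝ)
    (h1 : A.AssumptionOne μs zs us ys yinit μNM)
    (h2 : SPControl.Approximation.AssumptionTwo q zs μNM rQ zNM)
    (h3 : A.AssumptionThree zs ys rQ rB) :
    (∃ β : ℕ → ℕ → ℝ,
      (∀ N ≥ 1, ∀ M ≥ 1, D.IsNearOptimalACGFamily (β N M)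
        (fun z => A.ctrl N M z (yinit N M z)) (fun z => A.y N M z (yinit N M z))) ∧
      SPControl.DoubleLimZero β) ∧
    (∀ t ≥ 0, SPControl.DoubleLimZero fun N M =>
      sSup ((fun t' => dist (zNM N M t') (zs t')) '' Icc 0 t)) ∧
    (∀ᵐ t ∂SPControl.halfLine, SPControl.DoubleLimZero fun N M =>
      SPControl.rho q (μNM N M (zNM N M t)) (μs t)) ∧
    SPControl.DoubleLimZero fun N M =>
      |D.avgCost (fun t => μNM N M (zNM N M t)) (zNM N M) - D.avgValue| := by
  have hcost := SPControl.Approximation.tendsto_abs_avgCost_sub hq h1 h2 h3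
  -- The summand `1 / (N + 1)` makes `β` strictly positive even when the cost gap is zero.
  refine ⟨⟨fun N M => |D.avgCost (fun t => μNM N M (zNM N M t)) (zNM N M) - D.avgValue| +
    1 / ((N : ℝ) + 1), fun N hN M hM => ⟨by positivity, μNM N M, zNM N M,
      h1.isACGFamily hN hM (h2.solution N hN M hM), ?_⟩, ?_⟩, fun t ht => ?_, ?_, ?_⟩
  · have h := le_abs_self (D.avgCost (fun t => μNM N M (zNM N M t)) (zNM N M) - D.avgValue)
    have h' : 0 < 1 / ((N : ℝ) + 1) := by positivity
    linarith
  · have hinv : Tendsto (fun p : ℕ × ℕ => 1 / ((p.1 : ℝ) + 1)) SPControl.iteratedAtTop (𝓝 0) :=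
      (tendsto_one_div_add_atTop_nhds_zero_nat (𝕜 := ℝ)).comp
        (tendsto_fst.mono_left Filter.curry_le_prod)
    refine SPControl.doubleLimZero_of_tendsto (fun N _ M _ => by positivity) ?_
    simpa only [add_zero] using hcost.add hinv
  · refine SPControl.doubleLimZero_of_eventually_le (fun N _ M _ => ?_) fun ε hε => ?_
    · exact Real.sSup_nonneg (by rintro _ ⟨s, _, rfl⟩; exact dist_nonneg)
    -- The horizon `t + 1` covers `t = 0`, since the trajectory estimate needs a positive horizon.
    · filter_upwards [SPControl.Approximation.eventually_dist_trajectory_le h1 h2 h3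
        (T := t + 1) (by linarith) hε] with p hp
      refine Real.sSup_le ?_ hε.le
      rintro _ ⟨s, hs, rfl⟩
      exact hp s ⟨hs.1, by linarith [hs.2]⟩
  · filter_upwards [SPControl.Approximation.ae_tendsto_rho hq h1 h2 h3] with t ht
    exact SPControl.doubleLimZero_of_tendsto (fun N _ M _ => SPControl.rho_nonneg _ _ _) ht
  · exact SPControl.doubleLimZero_of_tendsto (fun N _ M _ => abs_nonneg _) hcost
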